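/- **Proposition (validity of DAG-Rider).** Consider $n=3f+1$ processes $p_1,\dots,p_n$, asynchronous communication, and an adaptive adversary that schedules all events and may corrupt up to $f$ processes during the run; corrupted processes behave arbitrarily, and a process is *correct* if it is never corrupted. Every correct process calls $a\_bcast(b,r)$ infinitely often, with consecutive sequence numbers $r=1,2,\dots$. Two building blocks are available. *Reliable broadcast* ($r\_bcast$, $r\_deliver$). Agreement: if a correct process outputs $r\_deliver(m,r,p_k)$, then with probability $1$ every correct process eventually does. Integrity: for each $(r,p_k)$ a correct process outputs $r\_deliver(m,r,p_k)$ at most once, regardless of $m$. Validity: if a correct $p_k$ calls $r\_bcast(m,r)$, then with probability $1$ every correct process eventually outputs $r\_deliver(m,r,p_k)$. *Global perfect coin* ($choose\_leader(w)$, $w\in\mathbb N$). There are random processes $X_w$, each uniform on the $n$ processes, such that every call of $choose\_leader(w)$ by a correct process that returns, returns $X_w$; if at least $f+1$ processes call $choose\_leader(w)$, then every such call by a correct process eventually returns; and as long as fewer than $f+1$ processes have called $choose\_leader(w)$, for each process $p_j$ the conditional probability of $X_w=p_j$, given everything the adversary knows (including the run so far), is at most $\frac1n+\varepsilon$. Here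 $\varepsilon$ is small: $f\left(\frac1n+\varepsilon\right)<1$. *The protocol DAG-Rider at $p_i$.* A vertex $v$ consists of a round, a source, a block, a set of strong edges (vertices of round $v.round-1$) and a set of weak edges (vertices of rounds $<v.round-1$). $DAG_i[0]$ is a fixed set of $2f+1$ vertices and $DAG_i[r]=\emptyset$ initially for $r\ge1$. A (strong) path from $v$ to $u$ in $DAG_i$ is a sequence $v=v_1,\dots,v_k=u$, $k\ge1$, in which each $v_l$, $l\ge2$, is in $\bigcup_{r\ge1}DAG_i[r]$ and is a strong or weak (resp. a strong) edge of $v_{l-1}$. - On $a\_bcast(b,r)$, $p_i$ appends $b$ to a queue. - On $r\_deliver(m,r,p_k)$, $p_i$ forms the vertex with content $m$, round $r$ and source $p_k$; if it has at least $2f+1$ strong edges, all to vertices of round $r-1$, and all its weak edges are to vertices of rounds $<r-1$, then $p_i$ puts it in a buffer. - A buffered vertex whose round is at most the current round of $p_i$ (initially $0$) is moved to $DAG_i$ once all its strong and weak edges lead to vertices of $DAG_i$. - When the current round $r$ satisfies $|DAG_i[r]|\ge 2f+1$, $p_i$ signals $wave\_ready(r/4)$ if $4\mid r$, and enters round $r+1$.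 As soon as the queue is non-empty, it dequeues a block $b$ and calls $r\_bcast$ for round $r+1$ with the vertex that has block $b$, strong edges to all of $DAG_i[r]$ and, for $r'=r-1,\dots,1$ in turn, weak edges to all $u\in DAG_i[r']$ to which it has no path yet. - The signals $wave\_ready(w)$ are handled in order. The leader vertex of a wave $w$ in $DAG_i$ is the vertex of $DAG_i[4(w-1)+1]$ whose source is the process returned by $choose\_leader(w)$, if there is one. To handle $wave\_ready(w)$, $p_i$ calls $choose\_leader(w)$ and waits for the answer. If wave $w$ has a leader vertex $v$ and at least $2f+1$ vertices of $DAG_i[4w]$ have a strong path to $v$, then $p_i$ pushes $v$ on an empty stack; for $w'=w-1$ down to $decidedWave+1$ (initially $decidedWave=0$), if wave $w'$ has a leader vertex $v'$ to which there is a strong path from the last pushed vertex, it pushes $v'$; it sets $decidedWave=w$; finally it pops the vertices one by one, and for each popped $v$ it outputs, in some deterministic order, $a\_deliver(u.block,u.round,u.source)$ for all not yet delivered $u\in\bigcup_{r\ge1}DAG_i[r]$ to which there is a path from $v$. Each step of this code that can be executed is eventually executed by a correct process, at a time chosen by the adversary. **Claim.** DAG-Rider satisfies the validity property of Byzantine Atomic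 Broadcast: with probability $1$, whenever a correct process $p_k$ calls $a\_bcast(b,r)$, every correct process $p_i$ eventually outputs $a\_deliver(b,r,p_k)$. -/

import Mathlib

open MeasureTheory

namespace DagRider

universe u v

/-- The `n = 3 f + 1` processes. -/
abbrev Proc (f : ℕ) : Type := Fin (3 * f + 1)

/-- A vertex of the DAG. The two edge sets are stored as lists; only membership in them matters. -/
structure Vertex (f : ℕ) (Block : Type u) where
  round : ℕ
  source : Proc f
  block : Block
  strongEdges : List (Vertex f Block)
  weakEdges : List (Vertex f Block)

/-- What a process hands to `r_bcast`: a vertex without its round and source, which are supplied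
by the reliable broadcast layer at delivery. -/
structure Message (f : ℕ) (Block : Type u) where
  block : Block
  strongEdges : List (Vertex f Block)
  weakEdges : List (Vertex f Block)

/-- The `k`-th round of wave `w`, namely `4 (w - 1) + k`. It is an integer, since the code also
signals the degenerate wave `0`, which contains no round with a possible leader. -/
def waveRound (w k : ℕ) : ℤ := 4 * ((w : ℤ) - 1) + k

section Paths

variable {f : ℕ} {Block : Type u}

/-- `path(v, u)` in the local DAG `D`: a sequence `v = v₁, …, v_k = u`, `k ≥ 1`, in which every
`v_i` with `i ≥ 2` lies in a round `≥ 1` of `D` and is a strong or weak edge of `v_{i-1}`. -/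
def Path (D : Finset (Vertex f Block)) : Vertex f Block → Vertex f Block → Prop :=
  Relation.ReflTransGen fun a b =>
    b ∈ D ∧ 1 ≤ b.round ∧ (b ∈ a.strongEdges ∨ b ∈ a.weakEdges)

/-- `strong_path(v, u)` in the local DAG `D`: as `Path`, with strong edges only. -/
def StrongPath (D : Finset (Vertex f Block)) : Vertex f Block → Vertex f Block → Prop :=
  Relation.ReflTransGen fun a b => b ∈ D ∧ 1 ≤ b.round ∧ b ∈ a.strongEdges

open Classical in
/-- `DAG[r]`. -/
noncomputable def layer (D : Finset (Vertex f Block)) (r : ℕ) : Finset (Vertex f Block) :=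
  D.filter fun v => v.round = r

open Classical in
/-- The loop of `set_weak_edges` on the vertex `v`, for the rounds `k, k - 1, …, 1`: every vertex
of the current round of the DAG to which `v` has no path yet becomes a weak edge of `v`. -/
noncomputable def setWeakEdges (D : Finset (Vertex f Block)) :
    ℕ → Vertex f Block → Vertex f Block
  | 0, v => v
  | k + 1, v =>
      setWeakEdges D k
        { v with
          weakEdges := v.weakEdges ++ ((layer D (k + 1)).filter fun u => ¬ Path D v u).toList }

/-- `create_new_vertex(round)` at process `i` with local DAG `D` and dequeued block `b`. -/
noncomputable def newVertex (D : Finset (Vertex f Block)) (i : Proc f) (round : ℕ) (b : Block) :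
    Vertex f Block :=
  setWeakEdges D (round - 2)
    { round := round
      source := i
      block := b
      strongEdges := (layer D (round - 1)).toList
      weakEdges := [] }

/-- The content of a vertex that is reliably broadcast. -/
def Vertex.toMessage (v : Vertex f Block) : Message f Block :=
  ⟨v.block, v.strongEdges, v.weakEdges⟩

/-- The vertex obtained from `r_deliver(m, r, k)`. -/
def Message.toVertex (m : Message f Block) (r : ℕ) (k : Proc f) : Vertex f Block :=
  ⟨r, k, m.block, m.strongEdges, m.weakEdges⟩

open Classical in
/-- The check on delivery: at least `2 f + 1` strong edges, all to vertices of the previous round,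
and weak edges only to vertices of rounds before the previous one. -/
def Vertex.Valid (v : Vertex f Block) : Prop :=
  2 * f + 1 ≤ v.strongEdges.toFinset.card ∧
  (∀ u ∈ v.strongEdges, u.round + 1 = v.round) ∧
  (∀ u ∈ v.weakEdges, u.round + 1 < v.round)

end Paths

/-- The local variables of a process. `dag` is the union of the sets `DAG[r]`. -/
structure LocalState (f : ℕ) (Block : Type u) where
  /-- The union over `r` of the sets `DAG[r]`. -/
  dag : Finset (Vertex f Block)
  round : ℕ
  buffer : Finset (Vertex f Block)
  /-- The queue `blocksToPropose`. -/
  blocks : List Block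
  /-- The number of `a_bcast` calls so far. -/
  seq : ℕ
  /-- The process has entered `round` and has not yet broadcast its vertex of that round. -/
  creating : Prop
  /-- Signals `wave_ready(w)` that are not handled yet, in the order in which they were raised. -/
  waves : List ℕ
  /-- The handler of the first wave in `waves` has called the coin and waits for the answer. -/
  calling : Prop
  /-- The answers of the coin obtained so far. -/
  coin : ℕ → Option (Proc f)
  decidedWave : ℕ
  deliveredVertices : Finset (Vertex f Block)
  /-- The sequence of all outputs `a_deliver(b, r, k)` so far. -/
  output : List (Block × ℕ × Proc f)

/-- The events at a process. -/
inductive Action (f : ℕ) (Block : Type u) where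
  /-- Nothing happens. -/
  | idle
  /-- The adversary corrupts the process. -/
  | corrupt
  /-- The process calls `a_bcast(b, r)`. -/
  | aBcast (b : Block) (r : ℕ)
  /-- The reliable broadcast layer outputs `r_deliver(m, r, k)` at the process. -/
  | rDeliver (m : Message f Block) (r : ℕ) (k : Proc f)
  /-- The process moves `v` from its buffer to its DAG. -/
  | addVertex (v : Vertex f Block)
  /-- The process has completed its round and enters the next one. -/
  | nextRound
  /-- The process creates its vertex of round `r` and calls `r_bcast(m, r)`. -/
  | rBcast (m : Message f Block) (r : ℕ)
  /-- The process calls `choose_leader(w)`. -/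
  | chooseLeader (w : ℕ)
  /-- The call `choose_leader(w)` returns `j`, and the handler of `wave_ready(w)` runs. -/
  | leader (w : ℕ) (j : Proc f)

/-- An event of the system: an action at a process. -/
structure Event (f : ℕ) (Block : Type u) where
  proc : Proc f
  act : Action f Block

section Algorithm

variable {f : ℕ} {Block : Type u}

def initialState (genesis : Finset (Vertex f Block)) : LocalState f Block where
  dag := genesis
  round := 0
  buffer := ∅
  blocks := []
  seq := 0
  creating := False
  waves := []
  calling := False
  coin := fun _ => none
  decidedWave := 0
  deliveredVertices := ∅
  output := []

open Classical in
/-- `get_wave_vertex_leader(w)`, where `none` stands for `⊥`. -/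
noncomputable def waveLeader (s : LocalState f Block) (w : ℕ) : Option (Vertex f Block) :=
  if h : ∃ v ∈ s.dag, (v.round : ℤ) = waveRound w 1 ∧ s.coin w = some v.source then
    some h.choose
  else
    none

open Classical in
/-- The loop over the waves `w'` from the given one down to `decidedWave + 1`. The arguments are
`w'`, the current leader and the stack (its top first); the result is the final stack. -/
noncomputable def pushLeaders (s : LocalState f Block) :
    ℕ → Vertex f Block → List (Vertex f Block) → List (Vertex f Block)
  | 0, _, stack => stack
  | w + 1, v, stack =>
      if w + 1 ≤ s.decidedWave then stack
      else
        match waveLeader s (w + 1) with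
        | none => pushLeaders s w v stack
        | some v' =>
            if StrongPath s.dag v v' then pushLeaders s w v' (v' :: stack)
            else pushLeaders s w v stack

open Classical in
/-- `order_vertices`, where `order` is the deterministic order in which a set of vertices is
delivered. -/
noncomputable def orderVertices (order : Finset (Vertex f Block) → List (Vertex f Block)) :
    List (Vertex f Block) → LocalState f Block → LocalState f Block
  | [], s => s
  | v :: stack, s =>
      let S := s.dag.filter fun v' => 0 < v'.round ∧ Path s.dag v v' ∧ v' ∉ s.deliveredVertices
      orderVertices order stack
        { s with
          deliveredVertices := s.deliveredVertices ∪ S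
          output := s.output ++ (order S).map fun v' => (v'.block, v'.round, v'.source) }

open Classical in
/-- The handler of `wave_ready(w)`, once the coin has answered. -/
noncomputable def waveReady (order : Finset (Vertex f Block) → List (Vertex f Block))
    (s : LocalState f Block) (w : ℕ) : LocalState f Block :=
  match waveLeader s w with
  | none => s
  | some v =>
      if (s.dag.filter fun v' =>
          (v'.round : ℤ) = waveRound w 4 ∧ StrongPath s.dag v' v).card < 2 * f + 1 then s
      else
        orderVertices order (pushLeaders s (w - 1) v [v]) { s with decidedWave := w }

/-- When a process that follows the protocol can perform an action. Deliveries and corruptions are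
not under the control of the process. -/
def Enabled (i : Proc f) (s : LocalState f Block) : Action f Block → Prop
  | .idle => True
  | .corrupt => True
  | .aBcast _ r => r = s.seq + 1
  | .rDeliver _ _ _ => True
  | .addVertex v =>
      v ∈ s.buffer ∧ v.round ≤ s.round ∧
        (∀ u ∈ v.strongEdges, u ∈ s.dag) ∧ (∀ u ∈ v.weakEdges, u ∈ s.dag)
  | .nextRound => ¬ s.creating ∧ 2 * f + 1 ≤ (layer s.dag s.round).card
  | .rBcast m r =>
      s.creating ∧ r = s.round ∧
        ∃ b ∈ s.blocks.head?, m = (newVertex s.dag i s.round b).toMessage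
  | .chooseLeader w => ¬ s.calling ∧ w ∈ s.waves.head?
  | .leader w _ => s.calling ∧ w ∈ s.waves.head?

open Classical in
/-- The effect of an action on the local state. -/
noncomputable def step (order : Finset (Vertex f Block) → List (Vertex f Block))
    (s : LocalState f Block) : Action f Block → LocalState f Block
  | .idle => s
  | .corrupt => s
  | .aBcast b _ => { s with blocks := s.blocks ++ [b], seq := s.seq + 1 }
  | .rDeliver m r k =>
      if (m.toVertex r k).Valid then { s with buffer := insert (m.toVertex r k) s.buffer } else s
  | .addVertex v => { s with dag := insert v s.dag, buffer := s.buffer.erase v }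
  | .nextRound =>
      { s with
        waves := if s.round % 4 = 0 then s.waves ++ [s.round / 4] else s.waves
        round := s.round + 1
        creating := True }
  | .rBcast _ _ => { s with blocks := s.blocks.tail, creating := False }
  | .chooseLeader _ => { s with calling := True }
  | .leader w j =>
      waveReady order
        { s with
          waves := s.waves.tail
          calling := False
          coin := Function.update s.coin w (some j) } w

/-- The local state of process `i` after the first `t` events of the run `ρ`. It is meaningful as
long as `i` is not corrupted. -/
noncomputable def stateAt (genesis : Finset (Vertex f Block))
    (order : Finset (Vertex f Block) → List (Vertex f Block))
    (ρ : ℕ → Event f Block) (i : Proc f) : ℕ → LocalState f Block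
  | 0 => initialState genesis
  | t + 1 =>
      open Classical in
      if (ρ t).proc = i then step order (stateAt genesis order ρ i t) (ρ t).act
      else stateAt genesis order ρ i t

end Algorithm

section Runs

variable {f : ℕ} {Block : Type u}

/-- A process is correct in a run if it is never corrupted. -/
def Correct (ρ : ℕ → Event f Block) (i : Proc f) : Prop :=
  ∀ t, ρ t ≠ ⟨i, .corrupt⟩

/-- The runs of the protocol under an asynchronous scheduler and an adaptive adversary. Corrupted
processes behave arbitrarily. -/
structure IsRun (genesis : Finset (Vertex f Block))
    (order : Finset (Vertex f Block) → List (Vertex f Block))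
    (ρ : ℕ → Event f Block) : Prop where
  /-- At most `f` processes are corrupted. -/
  corrupt_le : {i | ¬ Correct ρ i}.ncard ≤ f
  /-- A process follows the protocol as long as it is not corrupted. -/
  follows : ∀ t, (∀ t' < t, ρ t' ≠ ⟨(ρ t).proc, .corrupt⟩) →
    Enabled (ρ t).proc (stateAt genesis order ρ (ρ t).proc t) (ρ t).act
  /-- Every correct process atomically broadcasts infinitely many blocks. -/
  inputs : ∀ i, Correct ρ i → ∀ T, ∃ t ≥ T, ∃ b r, ρ t = ⟨i, .aBcast b r⟩
  /-- Correct processes eventually execute the steps of their code that can be executed. -/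
  fair_addVertex : ∀ i, Correct ρ i → ∀ t v,
    Enabled i (stateAt genesis order ρ i t) (.addVertex v) → ∃ t' ≥ t, ρ t' = ⟨i, .addVertex v⟩
  fair_nextRound : ∀ i, Correct ρ i → ∀ t,
    Enabled i (stateAt genesis order ρ i t) .nextRound → ∃ t' ≥ t, ρ t' = ⟨i, .nextRound⟩
  fair_rBcast : ∀ i, Correct ρ i → ∀ t,
    (∃ m r, Enabled i (stateAt genesis order ρ i t) (.rBcast m r)) →
      ∃ t' ≥ t, ∃ m r, ρ t' = ⟨i, .rBcast m r⟩
  fair_chooseLeader : ∀ i, Correct ρ i → ∀ t w,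
    Enabled i (stateAt genesis order ρ i t) (.chooseLeader w) →
      ∃ t' ≥ t, ρ t' = ⟨i, .chooseLeader w⟩

/-- The processes that have called `choose_leader(w)` before time `t`. -/
def callers (ρ : ℕ → Event f Block) (w t : ℕ) : Set (Proc f) :=
  {i | ∃ t' < t, ρ t' = ⟨i, .chooseLeader w⟩}

/-- The validity property of Byzantine atomic broadcast in a single run: whatever a correct process
atomically broadcasts is eventually delivered by every correct process. -/
def BABValidity (genesis : Finset (Vertex f Block))
    (order : Finset (Vertex f Block) → List (Vertex f Block))
    (ρ : ℕ → Event f Block) : Prop :=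
  ∀ k b r, Correct ρ k → (∃ t, ρ t = ⟨k, .aBcast b r⟩) →
    ∀ i, Correct ρ i → ∃ t, (b, r, k) ∈ (stateAt genesis order ρ i t).output

variable {Ω : Type v} [MeasurableSpace Ω]

/-- The guarantees of the reliable broadcast layer for a random run. -/
structure ReliableBroadcast (P : Measure Ω) (run : Ω → ℕ → Event f Block) : Prop where
  agreement : ∀ᵐ ω ∂P, ∀ i j m r k, Correct (run ω) i → Correct (run ω) j →
    (∃ t, run ω t = ⟨i, .rDeliver m r k⟩) → ∃ t, run ω t = ⟨j, .rDeliver m r k⟩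
  integrity : ∀ ω i m m' r k t t', Correct (run ω) i →
    run ω t = ⟨i, .rDeliver m r k⟩ → run ω t' = ⟨i, .rDeliver m' r k⟩ → t = t'
  validity : ∀ᵐ ω ∂P, ∀ k m r, Correct (run ω) k → (∃ t, run ω t = ⟨k, .rBcast m r⟩) →
    ∀ i, Correct (run ω) i → ∃ t, run ω t = ⟨i, .rDeliver m r k⟩

/-- The guarantees of the global perfect coin for a random run. `X w` is the outcome of instance
`w`, and `ℱ t` is all that the adversary knows when it chooses the event at time `t` (at least the
run up to and including that event). -/
structure GlobalPerfectCoin (P : Measure Ω) (ℱ : Filtration ℕ ‹MeasurableSpace Ω›)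
    (run : Ω → ℕ → Event f Block) (X : ℕ → Ω → Proc f) (ε : ℝ) : Prop where
  measurable : ∀ w, Measurable (X w)
  agreement : ∀ ω i w j, Correct (run ω) i →
    (∃ t, run ω t = ⟨i, .leader w j⟩) → j = X w ω
  termination : ∀ ω w, (∃ t, f + 1 ≤ (callers (run ω) w t).ncard) →
    ∀ i, Correct (run ω) i → ∀ t, run ω t = ⟨i, .chooseLeader w⟩ →
      ∃ t' > t, ∃ j, run ω t' = ⟨i, .leader w j⟩
  /-- As long as fewer than `f + 1` processes have called `choose_leader(w)`, given all that the
  adversary knows, every guess of the outcome is right with probability at most `1/n + ε`. -/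
  unpredictability : ∀ w t j (A : Set Ω), MeasurableSet[ℱ t] A →
    (∀ ω ∈ A, (callers (run ω) w t).ncard < f + 1) →
      P.real (A ∩ {ω | X w ω = j}) ≤ (1 / (3 * f + 1 : ℕ) + ε) * P.real A
  fairness : ∀ w j, P.real {ω | X w ω = j} = 1 / (3 * f + 1 : ℕ)

end Runs

end DagRider

namespace DagRider

universe u v

/-! ### Paths in local DAGs and the reach of a newly created vertex -/

section DagLemmas

variable {f : ℕ} {Block : Type u}

/-! The proof joins a deterministic statement about single runs to a conditional probability bound
for the coin.

Common core. When a correct process calls the coin for a wave `w ≥ 1`, its DAG has at least `2f+1`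
vertices in each round up to `4w`. Double counting of the strong edges from round `4w-1` to round
`4w-2` gives a vertex `u` hit by at least `f+1` vertices (`exists_popular`). The sources `V` of the
strong edges of `u` form the core, and `|V| ≥ 2f+1`. Every vertex of round `4w` in the DAG of any
correct process has `2f+1` strong edges, so one of them meets these `f+1` vertices, and it has a
strong path through `u` to each vertex below `u`. Hence if the coin picks a member of `V`, every
correct process commits the leader vertex (`GoodRun.commit`).

From commits to delivery. A vertex `x` of a correct process reaches all correct DAGs. From then on,
each new vertex of a correct process has a path to `x`; this is the purpose of weak edges. A late
committed leader has `2f+1` strong edges, one of them to a vertex of a correct process, so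
committing it delivers `x`. If `x` is never delivered, the coin therefore misses the core in all
late waves (`GoodRun.eventually_notMem_core`).

Probability. At the first call by a correct process, the core is fixed while at most `f` processes
have called, so the coin misses it with conditional probability at most `q = f(1/n+ε) < 1`, or `0`
if this is negative (`GlobalPerfectCoin.measure_inter_missesCore_le`). Let `C T` say that delivery
has failed up to time `T`, and let `N` be the intersection of the `C T`. A miss in one wave `w ≥ T`
has probability at most `q` given `C T`, and on `N` almost surely all late waves miss; letting `T →
∞` gives `P N ≤ q * P N`, so `P N = 0` (`measure_iInter_eq_zero_of_conditional`). No independence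
between waves is needed. Which processes stay correct depends on the run, so this is done for each
fixed set `S` of processes and a countable union is taken at the end. -/

theorem mem_layer {D : Finset (Vertex f Block)} {r : ℕ} {v : Vertex f Block} :
    v ∈ layer D r ↔ v ∈ D ∧ v.round = r := by
  classical
  simp [layer]

theorem layer_mono {D D' : Finset (Vertex f Block)} (h : D ⊆ D') (r : ℕ) :
    layer D r ⊆ layer D' r := fun v hv => by
  rw [mem_layer] at hv ⊢
  exact ⟨h hv.1, hv.2⟩

theorem Vertex.Valid.one_le_round {v : Vertex f Block} (h : v.Valid) : 1 ≤ v.round := by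
  classical
  obtain ⟨h1, h2, -⟩ := h
  have : 0 < v.strongEdges.toFinset.card := lt_of_lt_of_le (Nat.succ_pos (2 * f)) h1
  obtain ⟨u, hu⟩ := Finset.card_pos.1 this
  have := h2 u (by simpa using hu)
  omega

theorem Vertex.Valid.card_strongEdges [DecidableEq (Vertex f Block)] {v : Vertex f Block}
    (h : v.Valid) : 2 * f + 1 ≤ v.strongEdges.toFinset.card := by
  convert h.1

/-- Every edge of a vertex of positive round leads to a vertex of `D`. -/
def EdgeClosed (D : Finset (Vertex f Block)) : Prop :=
  ∀ v ∈ D, 1 ≤ v.round → ∀ u, u ∈ v.strongEdges ∨ u ∈ v.weakEdges → u ∈ D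

/-- Edges are stored in the vertices themselves, so a closed DAG that contains the start of a path
contains all of it. This carries paths from one process to another. -/
theorem EdgeClosed.path {D D' : Finset (Vertex f Block)} (hD' : EdgeClosed D')
    {v u : Vertex f Block} (hv : v ∈ D') (hr : 1 ≤ v.round) (h : Path D v u) :
    Path D' v u ∧ u ∈ D' ∧ 1 ≤ u.round := by
  induction h with
  | refl => exact ⟨.refl, hv, hr⟩
  | tail _ hbc ih =>
    have hc := hD' _ ih.2.1 ih.2.2 _ hbc.2.2
    exact ⟨ih.1.tail ⟨hc, hbc.2⟩, hc, hbc.2.1⟩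

/-- Only the first step of a path looks at the edges of `v`. The bound on rounds excludes the
trivial path, which would be lost because the extended vertex is a different vertex. -/
theorem Path.addWeakEdges {D : Finset (Vertex f Block)} {v u : Vertex f Block} (h : Path D v u)
    (hu : u.round < v.round) (l : List (Vertex f Block)) :
    Path D { v with weakEdges := v.weakEdges ++ l } u := by
  rcases Relation.ReflTransGen.cases_head h with rfl | ⟨c, hc, hcu⟩
  · exact absurd hu (lt_irrefl _)
  · refine Relation.ReflTransGen.head ⟨hc.1, hc.2.1, ?_⟩ hcu
    rcases hc.2.2 with h | h
    · exact .inl h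
    · exact .inr (List.mem_append_left _ h)

theorem setWeakEdges_fields (D : Finset (Vertex f Block)) (k : ℕ) (v : Vertex f Block) :
    (setWeakEdges D k v).round = v.round ∧ (setWeakEdges D k v).source = v.source ∧
      (setWeakEdges D k v).block = v.block ∧
      (setWeakEdges D k v).strongEdges = v.strongEdges := by
  induction k generalizing v with
  | zero => exact ⟨rfl, rfl, rfl, rfl⟩
  | succ k ih => exact ih _

theorem setWeakEdges_weakEdges (D : Finset (Vertex f Block)) (k : ℕ) (v u : Vertex f Block)
    (hu : u ∈ (setWeakEdges D k v).weakEdges) :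
    u ∈ v.weakEdges ∨ (u ∈ D ∧ 1 ≤ u.round ∧ u.round ≤ k) := by
  classical
  induction k generalizing v with
  | zero => exact .inl hu
  | succ k ih =>
    rcases ih _ hu with h | h
    · rcases List.mem_append.1 h with h | h
      · exact .inl h
      · simp only [Finset.mem_toList, Finset.mem_filter, mem_layer] at h
        exact .inr ⟨h.1.1, by omega, h.1.2.le⟩
    · exact .inr ⟨h.1, h.2.1, h.2.2.trans (Nat.le_succ k)⟩

theorem Path.setWeakEdges {D : Finset (Vertex f Block)} {v u : Vertex f Block} (h : Path D v u)
    (hu : u.round < v.round) (k : ℕ) : Path D (setWeakEdges D k v) u := by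
  induction k generalizing v with
  | zero => exact h
  | succ k ih => exact ih (h.addWeakEdges hu _) hu

theorem path_setWeakEdges {D : Finset (Vertex f Block)} {v u : Vertex f Block} {k : ℕ}
    (huD : u ∈ D) (hu1 : 1 ≤ u.round) (huk : u.round ≤ k) (huv : u.round < v.round) :
    Path D (setWeakEdges D k v) u := by
  classical
  induction k generalizing v with
  | zero => omega
  | succ k ih =>
    rcases huk.lt_or_eq with h | h
    · exact ih (by omega) huv
    · rw [DagRider.setWeakEdges]
      refine Path.setWeakEdges (v := { v with weakEdges := _ }) ?_ huv k
      by_cases hp : Path D v u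
      · exact hp.addWeakEdges huv _
      · refine Relation.ReflTransGen.single ⟨huD, hu1, .inr ?_⟩
        refine List.mem_append_right _ ?_
        simp only [Finset.mem_toList, Finset.mem_filter, mem_layer]
        exact ⟨⟨huD, h⟩, hp⟩

theorem newVertex_round (D : Finset (Vertex f Block)) (i : Proc f) (r : ℕ) (b : Block) :
    (newVertex D i r b).round = r := (setWeakEdges_fields D _ _).1

theorem newVertex_source (D : Finset (Vertex f Block)) (i : Proc f) (r : ℕ) (b : Block) :
    (newVertex D i r b).source = i := (setWeakEdges_fields D _ _).2.1

theorem newVertex_block (D : Finset (Vertex f Block)) (i : Proc f) (r : ℕ) (b : Block) :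
    (newVertex D i r b).block = b := (setWeakEdges_fields D _ _).2.2.1

theorem newVertex_strongEdges (D : Finset (Vertex f Block)) (i : Proc f) (r : ℕ) (b : Block) :
    (newVertex D i r b).strongEdges = (layer D (r - 1)).toList :=
  (setWeakEdges_fields D _ _).2.2.2

theorem toVertex_toMessage (v : Vertex f Block) :
    v.toMessage.toVertex v.round v.source = v := by
  cases v
  rfl

theorem toMessage_toVertex (m : Message f Block) (r : ℕ) (k : Proc f) :
    (m.toVertex r k).toMessage = m := by
  cases m
  rfl

theorem toVertex_toMessage_newVertex (D : Finset (Vertex f Block)) (i : Proc f) (r : ℕ)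
    (b : Block) : (newVertex D i r b).toMessage.toVertex r i = newVertex D i r b := by
  have h := toVertex_toMessage (newVertex D i r b)
  rwa [newVertex_round, newVertex_source] at h

theorem newVertex_edges_mem {D : Finset (Vertex f Block)} {i : Proc f} {r : ℕ} {b : Block}
    {u : Vertex f Block}
    (hu : u ∈ (newVertex D i r b).strongEdges ∨ u ∈ (newVertex D i r b).weakEdges) : u ∈ D := by
  rcases hu with hu | hu
  · rw [newVertex_strongEdges, Finset.mem_toList, mem_layer] at hu
    exact hu.1
  · rcases setWeakEdges_weakEdges _ _ _ _ hu with h | h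
    · simp at h
    · exact h.1

theorem newVertex_valid {D : Finset (Vertex f Block)} (i : Proc f) {r : ℕ} (b : Block)
    (hr : 1 ≤ r) (hD : 2 * f + 1 ≤ (layer D (r - 1)).card) : (newVertex D i r b).Valid := by
  classical
  refine ⟨?_, fun u hu => ?_, fun u hu => ?_⟩
  · rw [newVertex_strongEdges]
    convert hD
    exact Finset.toList_toFinset _
  · rw [newVertex_strongEdges, Finset.mem_toList, mem_layer] at hu
    rw [newVertex_round]
    omega
  · rw [newVertex_round]
    rcases setWeakEdges_weakEdges _ _ _ _ hu with h | h
    · simp at h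
    · omega

/-- Round `r - 1` is reached by strong edges; for lower rounds the weak-edge loop adds an edge
wherever a path is still missing. -/
theorem path_newVertex {D : Finset (Vertex f Block)} {u : Vertex f Block} (i : Proc f) {r : ℕ}
    (b : Block) (huD : u ∈ D) (hu1 : 1 ≤ u.round) (hur : u.round < r) :
    Path D (newVertex D i r b) u := by
  by_cases h : u.round = r - 1
  · refine Relation.ReflTransGen.single ⟨huD, hu1, .inl ?_⟩
    rw [newVertex_strongEdges, Finset.mem_toList, mem_layer]
    exact ⟨huD, h⟩
  · exact path_setWeakEdges huD hu1 (by omega) hur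

end DagLemmas

/-! ### Invariants and monotonicity of a single local state -/

section Steps

variable {f : ℕ} {Block : Type u} {genesis : Finset (Vertex f Block)}
  {order : Finset (Vertex f Block) → List (Vertex f Block)}

theorem orderVertices_eq (st : List (Vertex f Block)) (s : LocalState f Block) :
    ∃ D O, orderVertices order st s = { s with deliveredVertices := D, output := O } := by
  induction st generalizing s with
  | nil => exact ⟨_, _, rfl⟩
  | cons v st ih =>
    rw [orderVertices]
    obtain ⟨D, O, h⟩ := ih _
    exact ⟨D, O, h⟩

/-- The handler touches only three fields, so invariants about the other fields pass through it
without a look at leaders or paths. -/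
theorem waveReady_eq (s : LocalState f Block) (w : ℕ) :
    ∃ d D O, waveReady order s w =
      { s with decidedWave := d, deliveredVertices := D, output := O } := by
  classical
  rw [waveReady]
  split
  · exact ⟨_, _, _, rfl⟩
  · split_ifs
    · exact ⟨_, _, _, rfl⟩
    · obtain ⟨D, O, h⟩ := orderVertices_eq (order := order) (pushLeaders s (w - 1) _ [_])
        { s with decidedWave := w }
      exact ⟨_, D, O, h⟩

/-- The number of waves that have been handled: those signalled, one for each completed round that is
a multiple of `4`, except those that are still pending. -/
def LocalState.handled (s : LocalState f Block) : ℕ := (s.round + 3) / 4 - s.waves.length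

/-- The invariants of the local state of a process that follows the protocol. -/
structure LocalState.Inv (genesis : Finset (Vertex f Block)) (s : LocalState f Block) : Prop where
  dag_round : ∀ v ∈ s.dag, v.round ≤ s.round
  dag_valid : ∀ v ∈ s.dag, v ∈ genesis ∨
    (v.Valid ∧ ∀ u, u ∈ v.strongEdges ∨ u ∈ v.weakEdges → u ∈ s.dag)
  buffer_valid : ∀ v ∈ s.buffer, v.Valid
  layers : ∀ r < s.round, 2 * f + 1 ≤ (layer s.dag r).card
  waves_length : s.waves.length ≤ (s.round + 3) / 4
  waves_eq : s.waves = List.range' s.handled s.waves.length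
  creating : s.creating → 1 ≤ s.round ∧ s.seq + 1 = s.blocks.length + s.round
  not_creating : ¬ s.creating → s.seq = s.blocks.length + s.round
  calling : s.calling → s.waves ≠ []

theorem inv_initialState (hg : ∀ v ∈ genesis, v.round = 0) :
    (initialState genesis).Inv genesis where
  dag_round v hv := (hg v hv).le
  dag_valid v hv := .inl hv
  buffer_valid v hv := by simp [initialState] at hv
  layers r hr := by simp [initialState] at hr
  waves_length := by simp [initialState]
  waves_eq := by simp [initialState]
  creating h := h.elim
  not_creating _ := rfl
  calling h := h.elim

/-- Two counts drive the arithmetic. There are `(round + 3) / 4` multiples of `4` below `round`, the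
degenerate wave `0` included, and the pending waves are the last consecutive ones signalled. The
number of dequeued blocks, `seq - blocks.length`, is `round - 1` while the vertex of the round is
still to be created and `round` afterwards. -/
theorem LocalState.Inv.step {s : LocalState f Block} (hs : s.Inv genesis) {i : Proc f}
    {a : Action f Block} (ha : Enabled i s a) : (step order s a).Inv genesis := by
  classical
  cases a with
  | idle => exact hs
  | corrupt => exact hs
  | aBcast b r =>
    refine { hs with creating := fun h => ?_, not_creating := fun h => ?_ }
    · have := hs.creating h
      simp only [DagRider.step, List.length_append, List.length_singleton]
      omega
    · have := hs.not_creating h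
      simp only [DagRider.step, List.length_append, List.length_singleton]
      omega
  | rDeliver m r k =>
    rw [DagRider.step]
    split_ifs with h
    · refine { hs with buffer_valid := fun v hv => ?_ }
      rcases Finset.mem_insert.1 hv with rfl | hv
      · exact h
      · exact hs.buffer_valid v hv
    · exact hs
  | addVertex v =>
    obtain ⟨hv, hr, h1, h2⟩ := ha
    refine { hs with
      dag_round := fun u hu => ?_
      dag_valid := fun u hu => ?_
      buffer_valid := fun u hu => hs.buffer_valid u (Finset.mem_of_mem_erase hu)
      layers := fun r h => (hs.layers r h).trans
        (Finset.card_le_card (layer_mono (Finset.subset_insert _ _) r)) }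
    · rcases Finset.mem_insert.1 hu with rfl | hu
      · exact hr
      · exact hs.dag_round u hu
    · rcases Finset.mem_insert.1 hu with rfl | hu
      · exact .inr ⟨hs.buffer_valid _ hv, fun x hx =>
          Finset.mem_insert_of_mem (hx.elim (h1 x) (h2 x))⟩
      · exact (hs.dag_valid u hu).imp_right fun h =>
          ⟨h.1, fun x hx => Finset.mem_insert_of_mem (h.2 x hx)⟩
  | nextRound =>
    obtain ⟨hc, hl⟩ := ha
    have hn := hs.not_creating hc
    refine { hs with
      dag_round := fun v hv => (hs.dag_round v hv).trans (Nat.le_succ _)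
      layers := fun r hr => ?_
      waves_length := ?_
      waves_eq := ?_
      creating := fun _ => ⟨Nat.succ_pos _, ?_⟩
      not_creating := fun h => (h trivial).elim
      calling := fun h => ?_ }
    · rcases (Nat.lt_succ_iff.1 hr).lt_or_eq with h | rfl
      · exact hs.layers r h
      · exact hl
    · have := hs.waves_length
      simp only [DagRider.step]
      split_ifs
      · simp only [List.length_append, List.length_singleton]
        omega
      · omega
    · have := hs.waves_length
      have hw := hs.waves_eq
      simp only [LocalState.handled] at hw
      simp only [DagRider.step, LocalState.handled]
      split_ifs
      · simp only [List.length_append, List.length_singleton]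
        rw [List.range'_1_concat]
        congr 1
        · conv_lhs => rw [hw]
          congr 1
          omega
        · congr 1
          omega
      · conv_lhs => rw [hw]
        congr 1
        omega
    · simp only [DagRider.step]
      omega
    · have := hs.calling h
      simp only [DagRider.step]
      split_ifs
      · simp
      · exact this
  | rBcast m r =>
    obtain ⟨hc, -, b, hb, -⟩ := ha
    have hn := hs.creating hc
    refine { hs with
      creating := fun h => h.elim
      not_creating := fun _ => ?_ }
    have : 0 < s.blocks.length := by
      cases h : s.blocks with
      | nil => simp [h] at hb
      | cons x l => simp
    simp only [DagRider.step, List.length_tail]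
    omega
  | chooseLeader w =>
    refine { hs with calling := fun _ h => ?_ }
    simp only [Enabled] at ha
    change s.waves = [] at h
    simp [h] at ha
  | leader w j =>
    simp only [DagRider.step]
    obtain ⟨d, D, O, h⟩ := waveReady_eq (order := order) { s with
        waves := s.waves.tail
        calling := False
        coin := Function.update s.coin w (some j) } w
    rw [h]
    refine { hs with
      waves_length := ?_
      waves_eq := ?_
      calling := fun h => h.elim }
    · have := hs.waves_length
      simp only [List.length_tail]
      omega
    · have := hs.waves_length
      have hw := hs.waves_eq
      have hne := hs.calling ha.1
      simp only [LocalState.handled] at hw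
      simp only [LocalState.handled]
      cases hwv : s.waves with
      | nil => exact absurd hwv hne
      | cons x l =>
        rw [hwv] at hw this
        simp only [List.length_cons] at hw this
        simp only [List.tail_cons]
        rw [List.range'_succ] at hw
        conv_lhs => rw [(List.cons.inj hw).2]
        congr 1
        omega

theorem LocalState.Inv.edgeClosed {s : LocalState f Block} (hs : s.Inv genesis)
    (hg : ∀ v ∈ genesis, v.round = 0) : EdgeClosed s.dag := by
  intro v hv hr u hu
  rcases hs.dag_valid v hv with h | h
  · have := hg v h
    omega
  · exact h.2 u hu

theorem LocalState.Inv.valid {s : LocalState f Block} (hs : s.Inv genesis)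
    (hg : ∀ v ∈ genesis, v.round = 0) {v : Vertex f Block} (hv : v ∈ s.dag) (hr : 1 ≤ v.round) :
    v.Valid := by
  rcases hs.dag_valid v hv with h | h
  · have := hg v h
    omega
  · exact h.1

theorem LocalState.Inv.mem_waves {s : LocalState f Block} (hs : s.Inv genesis) {w : ℕ}
    (hw : w ∈ s.waves) : s.handled ≤ w ∧ 4 * w < s.round := by
  have h1 := hs.waves_length
  have h2 := hs.waves_eq
  rw [h2, List.mem_range'_1] at hw
  simp only [LocalState.handled] at hw ⊢
  omega

/-- Since waves are signalled and handled consecutively from `0`, the next one is numbered by how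
many have been handled; `4 * w < s.round` says that it has been signalled. -/
theorem LocalState.Inv.head_waves {s : LocalState f Block} (hs : s.Inv genesis) {w : ℕ} :
    w ∈ s.waves.head? ↔ s.handled = w ∧ 4 * w < s.round := by
  have h1 := hs.waves_length
  have h2 := hs.waves_eq
  constructor
  · intro hw
    refine ⟨?_, (hs.mem_waves (List.mem_of_mem_head? hw)).2⟩
    rw [h2] at hw
    cases hl : s.waves.length with
    | zero => simp [hl] at hw
    | succ n => simpa [hl, List.range'_succ] using hw
  · rintro ⟨rfl, h⟩
    rw [h2]
    cases hl : s.waves.length with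
    | zero =>
      simp only [LocalState.handled, hl] at h
      omega
    | succ n => simp [List.range'_succ]

/-- The variables that only grow along a run. -/
structure LocalState.Le (s s' : LocalState f Block) : Prop where
  dag : s.dag ⊆ s'.dag
  dag_buffer : ∀ v ∈ s.buffer, v ∈ s'.buffer ∨ v ∈ s'.dag
  round : s.round ≤ s'.round
  seq : s.seq ≤ s'.seq
  output : ∀ x ∈ s.output, x ∈ s'.output

theorem LocalState.Le.refl (s : LocalState f Block) : s.Le s :=
  ⟨subset_rfl, fun _ => .inl, le_rfl, le_rfl, fun _ => id⟩

theorem LocalState.Le.trans {s s' s'' : LocalState f Block} (h : s.Le s') (h' : s'.Le s'') :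
    s.Le s'' :=
  ⟨h.dag.trans h'.dag,
    fun v hv => (h.dag_buffer v hv).elim (h'.dag_buffer v) fun h => .inr (h'.dag h),
    h.round.trans h'.round, h.seq.trans h'.seq, fun x hx => h'.output x (h.output x hx)⟩

theorem orderVertices_output_mono (st : List (Vertex f Block)) (s : LocalState f Block) :
    ∀ x ∈ s.output, x ∈ (orderVertices order st s).output := by
  induction st generalizing s with
  | nil => exact fun _ => id
  | cons v st ih =>
    intro x hx
    rw [orderVertices]
    exact ih _ x (List.mem_append_left _ hx)

theorem waveReady_output_mono (s : LocalState f Block) (w : ℕ) :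
    ∀ x ∈ s.output, x ∈ (waveReady order s w).output := by
  classical
  rw [waveReady]
  split
  · exact fun _ => id
  · split_ifs
    · exact fun _ => id
    · exact orderVertices_output_mono _ { s with decidedWave := w }

theorem LocalState.le_step (s : LocalState f Block) (a : Action f Block) :
    s.Le (DagRider.step order s a) := by
  classical
  cases a with
  | idle => exact .refl s
  | corrupt => exact .refl s
  | aBcast b r => exact { LocalState.Le.refl s with seq := Nat.le_succ _ }
  | rDeliver m r k =>
    rw [DagRider.step]
    split_ifs
    · exact { LocalState.Le.refl s with
        dag_buffer := fun v hv => .inl (Finset.mem_insert_of_mem hv) }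
    · exact .refl s
  | addVertex v =>
    exact { LocalState.Le.refl s with
      dag := Finset.subset_insert _ _
      dag_buffer := fun u hu => by
        by_cases h : u = v
        · exact .inr (h ▸ Finset.mem_insert_self _ _)
        · exact .inl (Finset.mem_erase.2 ⟨h, hu⟩) }
  | nextRound => exact { LocalState.Le.refl s with round := Nat.le_succ _ }
  | rBcast m r => exact { LocalState.Le.refl s with }
  | chooseLeader w => exact { LocalState.Le.refl s with }
  | leader w j =>
    have ho := waveReady_output_mono (order := order) { s with
        waves := s.waves.tail
        calling := False
        coin := Function.update s.coin w (some j) } w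
    simp only [DagRider.step]
    obtain ⟨d, D, O, h⟩ := waveReady_eq (order := order) { s with
        waves := s.waves.tail
        calling := False
        coin := Function.update s.coin w (some j) } w
    rw [h] at ho ⊢
    exact { LocalState.Le.refl s with output := ho }

/-- Everything that counts as delivered has been output. -/
def LocalState.DeliveredOutput (s : LocalState f Block) : Prop :=
  ∀ v ∈ s.deliveredVertices, (v.block, v.round, v.source) ∈ s.output

theorem LocalState.DeliveredOutput.orderVertices (horder : ∀ S, (order S).Perm S.toList)
    (st : List (Vertex f Block)) {s : LocalState f Block} (hs : s.DeliveredOutput) :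
    (orderVertices order st s).DeliveredOutput := by
  classical
  induction st generalizing s with
  | nil => exact hs
  | cons v st ih =>
    rw [DagRider.orderVertices]
    refine ih fun u hu => ?_
    rcases Finset.mem_union.1 hu with hu | hu
    · exact List.mem_append_left _ (hs u hu)
    · refine List.mem_append_right _ (List.mem_map.2 ⟨u, ?_, rfl⟩)
      exact (horder _).mem_iff.2 (Finset.mem_toList.2 hu)

theorem LocalState.DeliveredOutput.waveReady (horder : ∀ S, (order S).Perm S.toList)
    {s : LocalState f Block} (hs : s.DeliveredOutput) (w : ℕ) :
    (waveReady order s w).DeliveredOutput := by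
  classical
  rw [DagRider.waveReady]
  split
  · exact hs
  · split_ifs
    · exact hs
    · exact LocalState.DeliveredOutput.orderVertices horder _ hs

theorem LocalState.DeliveredOutput.step (horder : ∀ S, (order S).Perm S.toList)
    {s : LocalState f Block} (hs : s.DeliveredOutput) (a : Action f Block) :
    (step order s a).DeliveredOutput := by
  classical
  cases a with
  | rDeliver m r k =>
    rw [DagRider.step]
    split_ifs
    · exact hs
    · exact hs
  | leader w j =>
    exact LocalState.DeliveredOutput.waveReady horder (s := { s with
      waves := s.waves.tail
      calling := False
      coin := Function.update s.coin w (some j) }) hs w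
  | _ => exact hs

/-- When the turn of `v` comes, `u` is either delivered now or was delivered before; in the second
case `DeliveredOutput` supplies the output. -/
theorem orderVertices_output (horder : ∀ S, (order S).Perm S.toList)
    {st : List (Vertex f Block)} {s : LocalState f Block} (hs : s.DeliveredOutput)
    {v u : Vertex f Block} (hv : v ∈ st) (hu : u ∈ s.dag) (hr : 1 ≤ u.round)
    (h : Path s.dag v u) :
    (u.block, u.round, u.source) ∈ (orderVertices order st s).output := by
  classical
  induction st generalizing s with
  | nil => simp at hv
  | cons x st ih =>
    have hs' := LocalState.DeliveredOutput.orderVertices horder [x] hs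
    rw [DagRider.orderVertices, DagRider.orderVertices] at hs'
    rw [DagRider.orderVertices]
    rcases List.mem_cons.1 hv with rfl | hv
    · refine orderVertices_output_mono _ _ _ (hs' u ?_)
      simp only [Finset.mem_union, Finset.mem_filter]
      by_cases hd : u ∈ s.deliveredVertices
      · exact .inl hd
      · exact .inr ⟨hu, hr, h, hd⟩
    · exact ih hs' hv hu h

/-- The stack only grows, so the leader that triggers a commit is popped in any case, whichever
earlier leaders are pushed above it. -/
theorem mem_pushLeaders (s : LocalState f Block) (w : ℕ) (v x : Vertex f Block)
    {st : List (Vertex f Block)} (hx : x ∈ st) : x ∈ pushLeaders s w v st := by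
  induction w generalizing v st with
  | zero => exact hx
  | succ w ih =>
    rw [pushLeaders]
    split_ifs
    · exact hx
    · split
      · exact ih _ hx
      · split_ifs
        · exact ih _ (List.mem_cons_of_mem _ hx)
        · exact ih _ hx

theorem waveReady_output (horder : ∀ S, (order S).Perm S.toList)
    {s : LocalState f Block} (hs : s.DeliveredOutput) {w : ℕ} {v u : Vertex f Block}
    (hv : waveLeader s w = some v) {U : Finset (Vertex f Block)} (hU : 2 * f + 1 ≤ U.card)
    (hUs : ∀ y ∈ U, y ∈ s.dag ∧ (y.round : ℤ) = waveRound w 4 ∧ StrongPath s.dag y v)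
    (hu : u ∈ s.dag) (hr : 1 ≤ u.round) (h : Path s.dag v u) :
    (u.block, u.round, u.source) ∈ (waveReady order s w).output := by
  classical
  rw [waveReady, hv]
  simp only
  rw [if_neg]
  · exact orderVertices_output horder (s := { s with decidedWave := w }) hs
      (mem_pushLeaders _ _ _ v (List.mem_singleton_self v)) hu hr h
  · rw [not_lt]
    exact hU.trans (Finset.card_le_card fun y hy => Finset.mem_filter.2 (hUs y hy))

end Steps

/-! ### Runs: agreement on vertices and their spread between correct processes -/

section RunLemmas

variable {f : ℕ} {Block : Type u} {genesis : Finset (Vertex f Block)}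
  {order : Finset (Vertex f Block) → List (Vertex f Block)} {ρ : ℕ → Event f Block}

/-- Local states depend only on the past of the run; this makes events about them known to the
adversary. -/
theorem stateAt_congr {ρ' : ℕ → Event f Block} (i : Proc f) {t : ℕ}
    (h : ∀ s < t, ρ s = ρ' s) :
    stateAt genesis order ρ i t = stateAt genesis order ρ' i t := by
  induction t with
  | zero => rfl
  | succ t ih =>
    rw [stateAt, stateAt, ih fun s hs => h s (hs.trans (Nat.lt_succ_self t)),
      h t (Nat.lt_succ_self t)]

theorem stateAt_succ {i : Proc f} {t : ℕ} {a : Action f Block} (h : ρ t = ⟨i, a⟩) :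
    stateAt genesis order ρ i (t + 1) = step order (stateAt genesis order ρ i t) a := by
  rw [stateAt, h, if_pos rfl]

theorem stateAt_le {i : Proc f} {t t' : ℕ} (h : t ≤ t') :
    (stateAt genesis order ρ i t).Le (stateAt genesis order ρ i t') := by
  induction h with
  | refl => exact .refl _
  | step _ ih =>
    refine ih.trans ?_
    rw [stateAt]
    split_ifs
    · exact LocalState.le_step _ _
    · exact .refl _

theorem stateAt_deliveredOutput (horder : ∀ S, (order S).Perm S.toList) (i : Proc f) (t : ℕ) :
    (stateAt genesis order ρ i t).DeliveredOutput := by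
  induction t with
  | zero => intro v hv; simp [stateAt, initialState] at hv
  | succ t ih =>
    rw [stateAt]
    split_ifs
    · exact ih.step horder _
    · exact ih

theorem IsRun.enabled (hrun : IsRun genesis order ρ) {i : Proc f} (hi : Correct ρ i) {t : ℕ}
    {a : Action f Block} (h : ρ t = ⟨i, a⟩) : Enabled i (stateAt genesis order ρ i t) a := by
  have := hrun.follows t fun t' _ => by rw [h]; exact hi t'
  rwa [h] at this

theorem IsRun.induction (hrun : IsRun genesis order ρ) {i : Proc f} (hi : Correct ρ i)
    {I : ℕ → LocalState f Block → Prop} {t₀ : ℕ} (h0 : I t₀ (stateAt genesis order ρ i t₀))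
    (hidle : ∀ t ≥ t₀, ∀ s, (ρ t).proc ≠ i → I t s → I (t + 1) s)
    (hstep : ∀ t ≥ t₀, ∀ a, ρ t = ⟨i, a⟩ → Enabled i (stateAt genesis order ρ i t) a →
      I t (stateAt genesis order ρ i t) → I (t + 1) (step order (stateAt genesis order ρ i t) a))
    {t : ℕ} (ht : t₀ ≤ t) : I t (stateAt genesis order ρ i t) := by
  induction t, ht using Nat.le_induction with
  | base => exact h0
  | succ t ht ih =>
    rw [stateAt]
    split_ifs with h
    · have he : ρ t = ⟨i, (ρ t).act⟩ := by rw [← h]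
      exact hstep t ht _ he (hrun.enabled hi he) ih
    · exact hidle t ht _ h ih

theorem IsRun.inv (hrun : IsRun genesis order ρ) (hg : ∀ v ∈ genesis, v.round = 0) {i : Proc f}
    (hi : Correct ρ i) (t : ℕ) : (stateAt genesis order ρ i t).Inv genesis :=
  hrun.induction hi (I := fun _ s => s.Inv genesis) (t₀ := 0) (inv_initialState hg)
    (fun _ _ _ _ h => h) (fun _ _ _ _ ha h => h.step ha) (Nat.zero_le t)

theorem stateAt_round_succ (i : Proc f) (t : ℕ) :
    (stateAt genesis order ρ i (t + 1)).round = (stateAt genesis order ρ i t).round ∨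
    ((stateAt genesis order ρ i (t + 1)).round = (stateAt genesis order ρ i t).round + 1 ∧
      (stateAt genesis order ρ i (t + 1)).creating) := by
  classical
  rw [stateAt]
  split_ifs
  · generalize stateAt genesis order ρ i t = s
    cases (ρ t).act with
    | nextRound => exact .inr ⟨rfl, trivial⟩
    | leader w j =>
      simp only [step]
      obtain ⟨d, D, O, h⟩ := waveReady_eq (order := order) { s with
        waves := s.waves.tail
        calling := False
        coin := Function.update s.coin w (some j) } w
      rw [h]
      exact .inl rfl
    | rDeliver m r k =>
      rw [step]
      split_ifs <;> exact .inl rfl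
    | _ => exact .inl rfl
  · exact .inl rfl

theorem stateAt_round_le (i : Proc f) (t : ℕ) : (stateAt genesis order ρ i t).round ≤ t := by
  induction t with
  | zero => exact le_rfl
  | succ t ih =>
    rcases stateAt_round_succ (genesis := genesis) (order := order) (ρ := ρ) i t with h | h <;> omega

/-- A process enters every round up to its current one. -/
theorem stateAt_exists_creating (i : Proc f) {t r : ℕ} (hr : 1 ≤ r)
    (h : r ≤ (stateAt genesis order ρ i t).round) :
    ∃ t', (stateAt genesis order ρ i t').round = r ∧ (stateAt genesis order ρ i t').creating := by
  induction t with
  | zero =>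
    simp only [stateAt, initialState] at h
    omega
  | succ t ih =>
    by_cases hlt : r ≤ (stateAt genesis order ρ i t).round
    · exact ih hlt
    · rcases stateAt_round_succ (genesis := genesis) (order := order) (ρ := ρ) i t with h' | h'
      · omega
      · exact ⟨t + 1, by omega, h'.2⟩

/-- The vertices of a local DAG and of the buffer have been reliably delivered. -/
theorem stateAt_delivered {i : Proc f} (hrun : IsRun genesis order ρ) (hi : Correct ρ i) (t : ℕ) :
    ∀ v, v ∈ (stateAt genesis order ρ i t).dag ∨ v ∈ (stateAt genesis order ρ i t).buffer →
      v ∈ genesis ∨ ∃ t', ρ t' = ⟨i, .rDeliver v.toMessage v.round v.source⟩ := by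
  classical
  refine hrun.induction hi (I := fun _ s => ∀ v, v ∈ s.dag ∨ v ∈ s.buffer →
      v ∈ genesis ∨ ∃ t', ρ t' = ⟨i, .rDeliver v.toMessage v.round v.source⟩)
    (t₀ := 0) ?_ (fun _ _ _ _ h => h) ?_ (Nat.zero_le t)
  · rintro v (hv | hv)
    · exact .inl hv
    · simp [stateAt, initialState] at hv
  · intro t _ a hρ ha ih
    cases a with
    | rDeliver m r k =>
      rw [step]
      split_ifs
      · rintro v (hv | hv)
        · exact ih v (.inl hv)
        · rcases Finset.mem_insert.1 hv with rfl | hv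
          · exact .inr ⟨t, by rw [toMessage_toVertex]; exact hρ⟩
          · exact ih v (.inr hv)
      · exact ih
    | addVertex v =>
      rintro u (hu | hu)
      · rcases Finset.mem_insert.1 hu with rfl | hu
        · exact ih _ (.inr ha.1)
        · exact ih u (.inl hu)
      · exact ih u (.inr (Finset.mem_of_mem_erase hu))
    | leader w j =>
      simp only [step]
      obtain ⟨d, D, O, h⟩ := waveReady_eq (order := order)
        { stateAt genesis order ρ i t with
          waves := (stateAt genesis order ρ i t).waves.tail
          calling := False
          coin := Function.update (stateAt genesis order ρ i t).coin w (some j) } w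
      rw [h]
      exact ih
    | _ => exact ih

/-- A run of the protocol in which the building blocks keep their promises; `X` is the sequence of
the outcomes of the coin. -/
structure GoodRun (genesis : Finset (Vertex f Block))
    (order : Finset (Vertex f Block) → List (Vertex f Block))
    (ρ : ℕ → Event f Block) (X : ℕ → Proc f) : Prop extends IsRun genesis order ρ where
  genesis_card : 2 * f + 1 ≤ genesis.card
  genesis_round : ∀ v ∈ genesis, v.round = 0
  rb_agreement : ∀ i j m r k, Correct ρ i → Correct ρ j →
    (∃ t, ρ t = ⟨i, .rDeliver m r k⟩) → ∃ t, ρ t = ⟨j, .rDeliver m r k⟩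
  rb_integrity : ∀ i m m' r k t t', Correct ρ i →
    ρ t = ⟨i, .rDeliver m r k⟩ → ρ t' = ⟨i, .rDeliver m' r k⟩ → t = t'
  rb_validity : ∀ k m r, Correct ρ k → (∃ t, ρ t = ⟨k, .rBcast m r⟩) →
    ∀ i, Correct ρ i → ∃ t, ρ t = ⟨i, .rDeliver m r k⟩
  coin_agreement : ∀ i w j, Correct ρ i → (∃ t, ρ t = ⟨i, .leader w j⟩) → j = X w
  coin_termination : ∀ w, (∃ t, f + 1 ≤ (callers ρ w t).ncard) →
    ∀ i, Correct ρ i → ∀ t, ρ t = ⟨i, .chooseLeader w⟩ → ∃ t' > t, ∃ j, ρ t' = ⟨i, .leader w j⟩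

variable {X : ℕ → Proc f}

theorem GoodRun.inv (h : GoodRun genesis order ρ X) {i : Proc f} (hi : Correct ρ i) (t : ℕ) :
    (stateAt genesis order ρ i t).Inv genesis := h.toIsRun.inv h.genesis_round hi t

theorem GoodRun.edgeClosed (h : GoodRun genesis order ρ X) {i : Proc f} (hi : Correct ρ i)
    (t : ℕ) : EdgeClosed (stateAt genesis order ρ i t).dag := (h.inv hi t).edgeClosed h.genesis_round

theorem GoodRun.rDeliver_of_mem (h : GoodRun genesis order ρ X) {i : Proc f} (hi : Correct ρ i)
    {t : ℕ} {v : Vertex f Block} (hv : v ∈ (stateAt genesis order ρ i t).dag) (hr : 1 ≤ v.round) :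
    ∃ t', ρ t' = ⟨i, .rDeliver v.toMessage v.round v.source⟩ := by
  rcases stateAt_delivered h.toIsRun hi t v (.inl hv) with h' | h'
  · have := h.genesis_round v h'
    omega
  · exact h'

/-- Agreement brings the message of `i` to `j` as well, and integrity at `j` forbids two deliveries
for one round and source. -/
theorem GoodRun.eq_of_rDeliver (h : GoodRun genesis order ρ X) {i j : Proc f} (hi : Correct ρ i)
    (hj : Correct ρ j) {m m' : Message f Block} {r : ℕ} {k : Proc f}
    (hm : ∃ t, ρ t = ⟨i, .rDeliver m r k⟩) (hm' : ∃ t, ρ t = ⟨j, .rDeliver m' r k⟩) : m = m' := by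
  obtain ⟨t, ht⟩ := h.rb_agreement i j m r k hi hj hm
  obtain ⟨t', ht'⟩ := hm'
  have := h.rb_integrity j m m' r k t t' hj ht ht'
  subst this
  rw [ht] at ht'
  simpa using ht'

/-- Correct processes never hold different vertices of the same round and source. -/
theorem GoodRun.vertex_unique (h : GoodRun genesis order ρ X) {i j : Proc f} (hi : Correct ρ i)
    (hj : Correct ρ j) {t t' : ℕ} {u v : Vertex f Block}
    (hu : u ∈ (stateAt genesis order ρ i t).dag) (hv : v ∈ (stateAt genesis order ρ j t').dag)
    (hr : 1 ≤ u.round) (hrr : u.round = v.round) (hs : u.source = v.source) : u = v := by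
  have h1 := h.rDeliver_of_mem hi hu hr
  have h2 := h.rDeliver_of_mem hj hv (hrr ▸ hr)
  rw [← hrr, ← hs] at h2
  have := h.eq_of_rDeliver hi hj h1 h2
  rw [← toVertex_toMessage u, ← toVertex_toMessage v, this, hrr, hs]

theorem mem_buffer_or_dag {i : Proc f} {v : Vertex f Block}
    (hv : v.Valid) (hd : ∃ t, ρ t = ⟨i, .rDeliver v.toMessage v.round v.source⟩) :
    ∃ t, ∀ t' ≥ t, v ∈ (stateAt genesis order ρ i t').buffer ∨
      v ∈ (stateAt genesis order ρ i t').dag := by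
  classical
  obtain ⟨t, ht⟩ := hd
  refine ⟨t + 1, fun t' h' => (stateAt_le h').dag_buffer v ?_⟩
  rw [stateAt_succ ht, step, toVertex_toMessage, if_pos hv]
  exact Finset.mem_insert_self _ _

/-- A valid vertex that is delivered to a correct process enters its DAG, once its edges have done
so and the process has reached its round. -/
theorem GoodRun.exists_mem_dag (h : GoodRun genesis order ρ X) {i : Proc f} (hi : Correct ρ i)
    {v : Vertex f Block} (hv : v.Valid)
    (hd : ∃ t, ρ t = ⟨i, .rDeliver v.toMessage v.round v.source⟩)
    (hround : ∃ t, v.round ≤ (stateAt genesis order ρ i t).round)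
    (hedges : ∀ u, u ∈ v.strongEdges ∨ u ∈ v.weakEdges →
      ∃ t, u ∈ (stateAt genesis order ρ i t).dag) :
    ∃ t, v ∈ (stateAt genesis order ρ i t).dag := by
  classical
  obtain ⟨t₁, ht₁⟩ := mem_buffer_or_dag (genesis := genesis) (order := order) hv hd
  obtain ⟨t₂, ht₂⟩ := hround
  have : ∃ T, ∀ u ∈ v.strongEdges.toFinset ∪ v.weakEdges.toFinset,
      u ∈ (stateAt genesis order ρ i T).dag := by
    have hE : ∀ u ∈ v.strongEdges.toFinset ∪ v.weakEdges.toFinset,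
        ∃ t, u ∈ (stateAt genesis order ρ i t).dag := fun u hu => hedges u (by simpa using hu)
    choose! T hT using hE
    exact ⟨(v.strongEdges.toFinset ∪ v.weakEdges.toFinset).sup T, fun u hu =>
      (stateAt_le (Finset.le_sup hu)).dag (hT u hu)⟩
  obtain ⟨t₃, ht₃⟩ := this
  set t := max t₁ (max t₂ t₃)
  have h3 : t₃ ≤ t := by omega
  rcases ht₁ t (by omega) with hb | hb
  · obtain ⟨t', -, ht'⟩ := h.fair_addVertex i hi t v ⟨hb,
      ht₂.trans (stateAt_le (by omega : t₂ ≤ t)).round,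
      fun u hu => (stateAt_le h3).dag (ht₃ u (by simp [hu])),
      fun u hu => (stateAt_le h3).dag (ht₃ u (by simp [hu]))⟩
    refine ⟨t' + 1, ?_⟩
    rw [stateAt_succ ht']
    exact Finset.mem_insert_self _ _
  · exact ⟨t, hb⟩

/-- Vertices spread to all correct processes that reach their round. -/
theorem GoodRun.dag_spread (h : GoodRun genesis order ρ X) {i j : Proc f} (hi : Correct ρ i)
    (hj : Correct ρ j) {R : ℕ} (hR : ∃ t, R ≤ (stateAt genesis order ρ j t).round) {t : ℕ} :
    ∀ n ≤ R, ∀ v ∈ (stateAt genesis order ρ i t).dag, v.round = n →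
      ∃ t', v ∈ (stateAt genesis order ρ j t').dag := by
  intro n
  induction n using Nat.strong_induction_on with
  | _ n ih =>
    rintro hn v hv rfl
    rcases (h.inv hi t).dag_valid v hv with hv' | ⟨hv', he⟩
    · exact ⟨0, hv'⟩
    · obtain ⟨t₂, ht₂⟩ := hR
      refine h.exists_mem_dag hj hv'
        (h.rb_agreement i j _ _ _ hi hj (h.rDeliver_of_mem hi hv hv'.one_le_round))
        ⟨t₂, hn.trans ht₂⟩ fun u hu => ?_
      have hlt : u.round < v.round := by
        rcases hu with hu' | hu'
        · have := hv'.2.1 u hu'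
          omega
        · have := hv'.2.2 u hu'
          omega
      -- Edges lead to strictly lower rounds, so strong induction on the round puts them into the
      -- DAG of `j` first.
      exact ih _ hlt (hlt.le.trans hn) u (he u hu) rfl

end RunLemmas

/-! ### Liveness of rounds, and the vertex that carries a given block -/

section Progress

variable {f : ℕ} {Block : Type u} {genesis : Finset (Vertex f Block)}
  {order : Finset (Vertex f Block) → List (Vertex f Block)} {ρ : ℕ → Event f Block}
  {X : ℕ → Proc f}

/-- At time `t`, process `i` reliably broadcasts its vertex of round `r`, with block `b`. -/
def Broadcasts (genesis : Finset (Vertex f Block))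
    (order : Finset (Vertex f Block) → List (Vertex f Block)) (ρ : ℕ → Event f Block)
    (i : Proc f) (r : ℕ) (b : Block) (t : ℕ) : Prop :=
  (stateAt genesis order ρ i t).creating ∧ (stateAt genesis order ρ i t).round = r ∧
    b ∈ (stateAt genesis order ρ i t).blocks.head? ∧
    ρ t = ⟨i, .rBcast (newVertex (stateAt genesis order ρ i t).dag i r b).toMessage r⟩

/-- A round cannot be left before its vertex is broadcast, and only a broadcast removes blocks. So a
single `a_bcast` in the meantime keeps the broadcast step enabled. -/
theorem IsRun.creating_until (hrun : IsRun genesis order ρ) {i : Proc f} (hi : Correct ρ i)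
    {t₀ r : ℕ} (hc : (stateAt genesis order ρ i t₀).creating)
    (hr : (stateAt genesis order ρ i t₀).round = r) {t : ℕ} (ht : t₀ ≤ t)
    (hno : ∀ t' ≥ t₀, t' < t → ¬ ∃ m r, ρ t' = ⟨i, .rBcast m r⟩) :
    (stateAt genesis order ρ i t).creating ∧ (stateAt genesis order ρ i t).round = r ∧
      ∀ t₁ ≥ t₀, t₁ < t → (∃ b r, ρ t₁ = ⟨i, .aBcast b r⟩) →
        (stateAt genesis order ρ i t).blocks ≠ [] := by
  classical
  refine hrun.induction hi (t₀ := t₀)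
    (I := fun t s => (∀ t' ≥ t₀, t' < t → ¬ ∃ m r, ρ t' = ⟨i, .rBcast m r⟩) →
      s.creating ∧ s.round = r ∧ ∀ t₁ ≥ t₀, t₁ < t → (∃ b r, ρ t₁ = ⟨i, .aBcast b r⟩) →
        s.blocks ≠ []) ?_ ?_ ?_ ht hno
  · exact fun _ => ⟨hc, hr, fun t₁ h h' => by omega⟩
  · intro t _ s hne ih hno
    obtain ⟨h1, h2, h3⟩ := ih fun t' h h' => hno t' h (by omega)
    refine ⟨h1, h2, fun t₁ ht₁ ht₁' => ?_⟩
    rcases (Nat.lt_succ_iff.1 ht₁').lt_or_eq with h | rfl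
    · exact h3 t₁ ht₁ h
    · rintro ⟨b, r, hb⟩
      exact absurd (by rw [hb]) hne
  · intro t ht a hρ ha ih hno
    obtain ⟨h1, h2, h3⟩ := ih fun t' h h' => hno t' h (by omega)
    have key : (∀ b r, a ≠ .aBcast b r) → (stateAt genesis order ρ i t).blocks =
        (step order (stateAt genesis order ρ i t) a).blocks →
        ∀ t₁ ≥ t₀, t₁ < t + 1 → (∃ b r, ρ t₁ = ⟨i, .aBcast b r⟩) →
        (step order (stateAt genesis order ρ i t) a).blocks ≠ [] := by
      intro hnb heq t₁ ht₁ ht₁' hb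
      rw [← heq]
      rcases (Nat.lt_succ_iff.1 ht₁').lt_or_eq with h | rfl
      · exact h3 t₁ ht₁ h hb
      · obtain ⟨b, r, hb⟩ := hb
        rw [hρ] at hb
        exact absurd (by simpa using hb) (hnb b r)
    cases a with
    | aBcast b r =>
      exact ⟨h1, h2, fun _ _ _ _ => by simp [step]⟩
    | nextRound => exact absurd h1 ha.1
    | rBcast m r' => exact absurd ⟨m, r', hρ⟩ (hno t ht (Nat.lt_succ_self t))
    | rDeliver m r k =>
      have : (step order (stateAt genesis order ρ i t) (.rDeliver m r k)).creating =
          (stateAt genesis order ρ i t).creating ∧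
          (step order (stateAt genesis order ρ i t) (.rDeliver m r k)).round =
          (stateAt genesis order ρ i t).round ∧
          (stateAt genesis order ρ i t).blocks =
          (step order (stateAt genesis order ρ i t) (.rDeliver m r k)).blocks := by
        rw [step]
        split_ifs <;> exact ⟨rfl, rfl, rfl⟩
      exact ⟨this.1 ▸ h1, this.2.1 ▸ h2, key (by simp) this.2.2⟩
    | leader w j =>
      have : (step order (stateAt genesis order ρ i t) (.leader w j)).creating =
          (stateAt genesis order ρ i t).creating ∧
          (step order (stateAt genesis order ρ i t) (.leader w j)).round =
          (stateAt genesis order ρ i t).round ∧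
          (stateAt genesis order ρ i t).blocks =
          (step order (stateAt genesis order ρ i t) (.leader w j)).blocks := by
        simp only [step]
        obtain ⟨d, D, O, h⟩ := waveReady_eq (order := order)
          { stateAt genesis order ρ i t with
            waves := (stateAt genesis order ρ i t).waves.tail
            calling := False
            coin := Function.update (stateAt genesis order ρ i t).coin w (some j) } w
        rw [h]
        exact ⟨rfl, rfl, rfl⟩
      exact ⟨this.1 ▸ h1, this.2.1 ▸ h2, key (by simp) this.2.2⟩
    | _ => exact ⟨h1, h2, key (by simp) rfl⟩

theorem IsRun.exists_broadcasts (hrun : IsRun genesis order ρ) {i : Proc f} (hi : Correct ρ i)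
    {r t : ℕ} (hr : 1 ≤ r) (ht : r ≤ (stateAt genesis order ρ i t).round) :
    ∃ t b, Broadcasts genesis order ρ i r b t := by
  classical
  obtain ⟨t₀, h1, h2⟩ := stateAt_exists_creating i hr ht
  have hex : ∃ t', t₀ ≤ t' ∧ ∃ m r, ρ t' = ⟨i, .rBcast m r⟩ := by
    by_contra hno
    push Not at hno
    obtain ⟨t₁, ht₁, hb⟩ := hrun.inputs i hi t₀
    obtain ⟨h3, h4, h5⟩ := hrun.creating_until hi h2 h1 (t := t₁ + 1) (by omega)
      fun t' h _ => by push Not; exact hno t' h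
    obtain ⟨b, l, hl⟩ := List.exists_cons_of_ne_nil (h5 t₁ ht₁ (Nat.lt_succ_self _) hb)
    obtain ⟨t', ht', m, r', h'⟩ := hrun.fair_rBcast i hi (t₁ + 1)
      ⟨_, _, h3, rfl, b, by simp [hl], rfl⟩
    exact hno t' (by omega) m r' h'
  -- Taking the first broadcast after the entry into round `r` ensures that the process is still in
  -- round `r`.
  obtain ⟨h3, m, r', hm⟩ := Nat.find_spec hex
  have hcr := hrun.creating_until hi h2 h1 h3 fun t' h h' hm => Nat.find_min hex h' ⟨h, hm⟩
  obtain ⟨hc, hr', b, hb, hmb⟩ := hrun.enabled hi hm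
  refine ⟨_, b, hcr.1, hcr.2.1, hb, ?_⟩
  rw [hm, hmb, hr', hcr.2.1]

theorem IsRun.card_correct (hrun : IsRun genesis order ρ) {S : Finset (Proc f)}
    (hS : ∀ i, i ∈ S ↔ Correct ρ i) : 2 * f + 1 ≤ S.card ∧ Sᶜ.card ≤ f := by
  classical
  have h := hrun.corrupt_le
  have h2 : {i | ¬ Correct ρ i} = ((Sᶜ : Finset (Proc f)) : Set (Proc f)) := by
    ext i
    simp [hS]
  rw [h2, Set.ncard_coe_finset] at h
  have := Finset.card_add_card_compl S
  rw [Fintype.card_fin] at this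
  omega

theorem exists_finset_correct (ρ : ℕ → Event f Block) :
    ∃ S : Finset (Proc f), ∀ i, i ∈ S ↔ Correct ρ i := by
  classical
  exact ⟨Finset.univ.filter (Correct ρ), by simp⟩

/-- The hypothesis asks only that `i` reaches round `r`, so that this can serve inside the induction
proving that all rounds are reached. -/
theorem GoodRun.broadcast_mem_dag (h : GoodRun genesis order ρ X) {i j : Proc f}
    (hi : Correct ρ i) (hj : Correct ρ j) {r : ℕ} {b : Block} {t : ℕ}
    (hb : Broadcasts genesis order ρ j r b t)
    (hr : ∃ t, r ≤ (stateAt genesis order ρ i t).round) :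
    ∃ t', newVertex (stateAt genesis order ρ j t).dag j r b ∈
      (stateAt genesis order ρ i t').dag := by
  obtain ⟨h1, h2, h3, h4⟩ := hb
  have hinv := h.inv hj t
  have hr1 : 1 ≤ r := h2 ▸ (hinv.creating h1).1
  refine h.exists_mem_dag hi (newVertex_valid j b hr1 (hinv.layers _ (by omega))) ?_ ?_ ?_
  · rw [newVertex_round, newVertex_source]
    exact h.rb_validity j _ _ hj ⟨t, h4⟩ i hi
  · rwa [newVertex_round]
  · intro u hu
    have hu' := newVertex_edges_mem hu
    exact h.dag_spread hj hi hr _ (h2 ▸ hinv.dag_round u hu') u hu' rfl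

theorem IsRun.finished_until (hrun : IsRun genesis order ρ) {i : Proc f} (hi : Correct ρ i)
    {t₀ r : ℕ} (hc : ¬ (stateAt genesis order ρ i t₀).creating)
    (hr : (stateAt genesis order ρ i t₀).round = r) {t : ℕ} (ht : t₀ ≤ t) :
    (¬ (stateAt genesis order ρ i t).creating ∧ (stateAt genesis order ρ i t).round = r) ∨
      r + 1 ≤ (stateAt genesis order ρ i t).round := by
  classical
  refine hrun.induction hi (t₀ := t₀) (I := fun _ s => (¬ s.creating ∧ s.round = r) ∨
      r + 1 ≤ s.round) (.inl ⟨hc, hr⟩) (fun _ _ _ _ h => h) ?_ ht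
  intro t _ a _ ha ih
  rcases ih with ⟨h1, h2⟩ | ih
  · cases a with
    | nextRound => exact .inr (by simp [step, h2])
    | rBcast m r => exact absurd ha.1 h1
    | rDeliver m r k =>
      rw [step]
      split_ifs <;> exact .inl ⟨h1, h2⟩
    | leader w j =>
      simp only [step]
      obtain ⟨d, D, O, h⟩ := waveReady_eq (order := order)
        { stateAt genesis order ρ i t with
          waves := (stateAt genesis order ρ i t).waves.tail
          calling := False
          coin := Function.update (stateAt genesis order ρ i t).coin w (some j) } w
      rw [h]
      exact .inl ⟨h1, h2⟩
    | _ => exact .inl ⟨h1, h2⟩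
  · exact .inr (ih.trans (LocalState.le_step _ a).round)

/-- Every correct process reaches every round. -/
theorem GoodRun.exists_round_le (h : GoodRun genesis order ρ X) (R : ℕ) :
    ∀ i, Correct ρ i → ∃ t, R ≤ (stateAt genesis order ρ i t).round := by
  classical
  induction R with
  | zero => exact fun i _ => ⟨0, Nat.zero_le _⟩
  | succ R ih =>
    intro i hi
    -- By induction all correct processes reach round `R` and broadcast a vertex there. These at
    -- least `2f+1` vertices have distinct sources and all enter the DAG of `i`.
    have hlayer : ∃ T, 2 * f + 1 ≤ (layer (stateAt genesis order ρ i T).dag R).card := by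
      rcases Nat.eq_zero_or_pos R with rfl | hR
      · refine ⟨0, h.genesis_card.trans (Finset.card_le_card fun v hv => ?_)⟩
        exact mem_layer.2 ⟨hv, h.genesis_round v hv⟩
      · obtain ⟨S, hS⟩ := exists_finset_correct ρ
        have hb : ∀ j ∈ S, ∃ t, ∃ v ∈ (stateAt genesis order ρ i t).dag,
            v.round = R ∧ v.source = j := by
          intro j hj
          have hj' := (hS j).1 hj
          obtain ⟨t, ht⟩ := ih j hj'
          obtain ⟨t, b, hb⟩ := h.toIsRun.exists_broadcasts hj' hR ht
          obtain ⟨t', ht'⟩ := h.broadcast_mem_dag hi hj' hb (ih i hi)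
          exact ⟨t', _, ht', newVertex_round _ _ _ _, newVertex_source _ _ _ _⟩
        have : Nonempty (Vertex f Block) :=
          (Finset.card_pos.1 (lt_of_lt_of_le (Nat.succ_pos _) h.genesis_card)).nonempty
        choose! T v hv using hb
        refine ⟨S.sup T, (h.toIsRun.card_correct hS).1.trans ?_⟩
        refine Finset.card_le_card_of_injOn v (fun j hj => ?_) fun j hj j' hj' he => ?_
        · exact mem_layer.2 ⟨(stateAt_le (Finset.le_sup hj)).dag (hv j hj).1, (hv j hj).2.1⟩
        · rw [← (hv j hj).2.2, he, (hv j' hj').2.2]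
    have hready : ∃ t₀, (stateAt genesis order ρ i t₀).round = R ∧
        ¬ (stateAt genesis order ρ i t₀).creating := by
      rcases Nat.eq_zero_or_pos R with rfl | hR
      · exact ⟨0, rfl, id⟩
      · obtain ⟨t, ht⟩ := ih i hi
        obtain ⟨t, b, h1, h2, h3, h4⟩ := h.toIsRun.exists_broadcasts hi hR ht
        refine ⟨t + 1, ?_, ?_⟩ <;> rw [stateAt_succ h4]
        · exact h2
        · exact id
    obtain ⟨T, hT⟩ := hlayer
    obtain ⟨t₀, h1, h2⟩ := hready
    rcases h.toIsRun.finished_until hi h2 h1 (le_max_left t₀ T) with ⟨h3, h4⟩ | h3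
    · obtain ⟨t', ht', he⟩ := h.fair_nextRound i hi (max t₀ T) ⟨h3, by
        rw [h4]
        exact hT.trans (Finset.card_le_card
          (layer_mono (stateAt_le (le_max_right t₀ T)).dag R))⟩
      refine ⟨t' + 1, ?_⟩
      rw [stateAt_succ he, ← h4]
      exact Nat.succ_le_succ (stateAt_le ht').round
    · exact ⟨_, h3⟩

theorem GoodRun.exists_mem_dag_of_mem (h : GoodRun genesis order ρ X) {i j : Proc f}
    (hi : Correct ρ i) (hj : Correct ρ j) {t : ℕ} {v : Vertex f Block}
    (hv : v ∈ (stateAt genesis order ρ i t).dag) :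
    ∃ t', v ∈ (stateAt genesis order ρ j t').dag :=
  h.dag_spread hi hj (h.exists_round_le v.round j hj) _ le_rfl v hv rfl

/-- The vertices of correct processes are those that they have broadcast. -/
theorem GoodRun.eq_newVertex (h : GoodRun genesis order ρ X) {i k : Proc f}
    (hi : Correct ρ i) (hk : Correct ρ k) {t : ℕ} {v : Vertex f Block}
    (hv : v ∈ (stateAt genesis order ρ i t).dag) (hr : 1 ≤ v.round) (hs : v.source = k) :
    ∃ t' b, (stateAt genesis order ρ k t').round = v.round ∧
      v = newVertex (stateAt genesis order ρ k t').dag k v.round b := by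
  obtain ⟨t₁, ht₁⟩ := h.exists_round_le v.round k hk
  obtain ⟨t', b, h1, h2, h3, h4⟩ := h.toIsRun.exists_broadcasts hk hr ht₁
  refine ⟨t', b, h2, ?_⟩
  have := h.eq_of_rDeliver hi hi (hs ▸ h.rDeliver_of_mem hi hv hr)
    (h.rb_validity k _ _ hk ⟨t', h4⟩ i hi)
  rw [← toVertex_toMessage_newVertex, ← this, ← hs, toVertex_toMessage]

/-- After `seq - blocks.length` blocks have left the queue, number `r` sits at index `r - 1 - (seq -
blocks.length)`. The additive form avoids truncated subtraction and covers only times at which the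
block is still queued. -/
theorem IsRun.blocks_getElem? (hrun : IsRun genesis order ρ) {k : Proc f} (hk : Correct ρ k)
    {t₀ : ℕ} {b : Block} {r : ℕ} (ht₀ : ρ t₀ = ⟨k, .aBcast b r⟩) {t : ℕ} (ht : t₀ + 1 ≤ t) {n : ℕ}
    (hn : n + (stateAt genesis order ρ k t).seq + 1 =
      r + (stateAt genesis order ρ k t).blocks.length) :
    (stateAt genesis order ρ k t).blocks[n]? = some b := by
  classical
  revert hn n
  refine hrun.induction hk (t₀ := t₀ + 1) (I := fun _ s => ∀ {n : ℕ},
    n + s.seq + 1 = r + s.blocks.length → s.blocks[n]? = some b) ?_ (fun _ _ _ _ h => h) ?_ ht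
  · intro n hn
    have hr : r = _ + 1 := hrun.enabled hk ht₀
    rw [stateAt_succ ht₀] at hn ⊢
    simp only [step, List.length_append, List.length_singleton] at hn ⊢
    have : n = (stateAt genesis order ρ k t₀).blocks.length := by omega
    subst this
    simp
  · intro t _ a _ ha ih
    cases a with
    | aBcast b' r' =>
      intro n hn
      simp only [step, List.length_append, List.length_singleton] at hn ⊢
      have h1 := ih (n := n) (by omega)
      rw [List.getElem?_append_left (List.getElem?_eq_some_iff.1 h1).1, h1]
    | rBcast m r' =>
      obtain ⟨-, -, b', hb', -⟩ := ha
      intro n hn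
      have : 0 < (stateAt genesis order ρ k t).blocks.length := by
        cases h : (stateAt genesis order ρ k t).blocks with
        | nil => simp [h] at hb'
        | cons x l => simp
      simp only [step, List.length_tail] at hn ⊢
      rw [List.getElem?_tail]
      exact ih (by omega)
    | rDeliver m r k =>
      rw [step]
      split_ifs <;> exact ih
    | leader w j =>
      simp only [step]
      obtain ⟨d, D, O, h⟩ := waveReady_eq (order := order)
        { stateAt genesis order ρ k t with
          waves := (stateAt genesis order ρ k t).waves.tail
          calling := False
          coin := Function.update (stateAt genesis order ρ k t).coin w (some j) } w
      rw [h]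
      exact ih
    | _ => exact ih

/-- A block that a correct process atomically broadcasts with sequence number `r` is the block of
its vertex of round `r`. -/
theorem GoodRun.exists_vertex_of_aBcast (h : GoodRun genesis order ρ X) {k : Proc f}
    (hk : Correct ρ k) {t₀ : ℕ} {b : Block} {r : ℕ} (ht₀ : ρ t₀ = ⟨k, .aBcast b r⟩) :
    ∃ x : Vertex f Block, x.block = b ∧ x.round = r ∧ x.source = k ∧ 1 ≤ x.round ∧
      ∃ t, x ∈ (stateAt genesis order ρ k t).dag := by
  have hr : r = _ + 1 := h.toIsRun.enabled hk ht₀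
  obtain ⟨t₁, ht₁⟩ := h.exists_round_le r k hk
  obtain ⟨t, b', hb⟩ := h.toIsRun.exists_broadcasts hk (by omega) ht₁
  have hbb : b' = b := by
    obtain ⟨h1, h2, h3, h4⟩ := hb
    have hseq := ((h.inv hk t).creating h1).2
    have hlen : 0 < (stateAt genesis order ρ k t).blocks.length := by
      cases hl : (stateAt genesis order ρ k t).blocks with
      | nil => simp [hl] at h3
      | cons x l => simp
    -- Broadcasting in round `r` with a non-empty queue needs `seq ≥ r`, while `seq = r - 1` just
    -- before the `a_bcast` of number `r`.
    have htt : t₀ + 1 ≤ t := by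
      by_contra hlt
      have := (stateAt_le (genesis := genesis) (order := order) (ρ := ρ) (i := k)
        (by omega : t ≤ t₀)).seq
      omega
    have h5 := h.toIsRun.blocks_getElem? hk ht₀ htt (n := 0) (by omega)
    rw [← List.head?_eq_getElem?] at h5
    rw [h5] at h3
    simpa using h3.symm
  subst hbb
  exact ⟨_, newVertex_block _ _ _ _, newVertex_round _ _ _ _, newVertex_source _ _ _ _,
    by rw [newVertex_round]; omega, h.broadcast_mem_dag hk hk hb (h.exists_round_le r k hk)⟩

end Progress

/-! ### Liveness of waves: every coin is called and answered -/

section Waves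

variable {f : ℕ} {Block : Type u} {genesis : Finset (Vertex f Block)}
  {order : Finset (Vertex f Block) → List (Vertex f Block)} {ρ : ℕ → Event f Block}
  {X : ℕ → Proc f}

theorem GoodRun.waiting_until (h : GoodRun genesis order ρ X) {i : Proc f} (hi : Correct ρ i)
    {t₀ w : ℕ} (hc : ¬ (stateAt genesis order ρ i t₀).calling)
    (hw : (stateAt genesis order ρ i t₀).handled = w) (hno : ∀ t, ρ t ≠ ⟨i, .chooseLeader w⟩)
    {t : ℕ} (ht : t₀ ≤ t) :
    ¬ (stateAt genesis order ρ i t).calling ∧ (stateAt genesis order ρ i t).handled = w := by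
  classical
  refine h.toIsRun.induction hi (t₀ := t₀) (I := fun _ s => ¬ s.calling ∧ s.handled = w) ⟨hc, hw⟩
    (fun _ _ _ _ h => h) ?_ ht
  rintro t _ a hρ ha ⟨h1, h2⟩
  have hinv := h.inv hi t
  cases a with
  | nextRound =>
    refine ⟨h1, ?_⟩
    have := hinv.waves_length
    simp only [LocalState.handled] at h2
    simp only [step, LocalState.handled]
    split_ifs
    · simp only [List.length_append, List.length_singleton]
      omega
    · omega
  | chooseLeader w' =>
    have := (hinv.head_waves.1 ha.2).1
    rw [h2] at this
    subst this
    exact absurd hρ (hno t)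
  | leader w' j => exact absurd ha.1 h1
  | rDeliver m r k =>
    rw [step]
    split_ifs <;> exact ⟨h1, h2⟩
  | _ => exact ⟨h1, h2⟩

theorem GoodRun.exists_chooseLeader_of_waiting (h : GoodRun genesis order ρ X) {i : Proc f}
    (hi : Correct ρ i) {t₀ w : ℕ} (hc : ¬ (stateAt genesis order ρ i t₀).calling)
    (hw : (stateAt genesis order ρ i t₀).handled = w) : ∃ t, ρ t = ⟨i, .chooseLeader w⟩ := by
  by_contra hno
  push Not at hno
  obtain ⟨t₁, ht₁⟩ := h.exists_round_le (4 * w + 1) i hi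
  obtain ⟨h1, h2⟩ := h.waiting_until hi hc hw hno (le_max_left t₀ t₁)
  obtain ⟨t', -, ht'⟩ := h.fair_chooseLeader i hi (max t₀ t₁) w
    ⟨h1, (h.inv hi _).head_waves.2 ⟨h2, ht₁.trans (stateAt_le (le_max_right t₀ t₁)).round⟩⟩
  exact hno t' ht'

theorem GoodRun.handled_succ (h : GoodRun genesis order ρ X) {i : Proc f} (hi : Correct ρ i)
    {t w : ℕ} {j : Proc f} (ht : ρ t = ⟨i, .leader w j⟩) :
    ¬ (stateAt genesis order ρ i (t + 1)).calling ∧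
      (stateAt genesis order ρ i (t + 1)).handled = w + 1 := by
  have hinv := h.inv hi t
  obtain ⟨h1, h2⟩ := h.toIsRun.enabled hi ht
  obtain ⟨h3, -⟩ := hinv.head_waves.1 h2
  have h4 := hinv.waves_length
  have h5 := List.length_pos_iff.2 (hinv.calling h1)
  rw [stateAt_succ ht]
  simp only [step]
  obtain ⟨d, D, O, he⟩ := waveReady_eq (order := order)
    { stateAt genesis order ρ i t with
      waves := (stateAt genesis order ρ i t).waves.tail
      calling := False
      coin := Function.update (stateAt genesis order ρ i t).coin w (some j) } w
  rw [he]
  refine ⟨id, ?_⟩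
  simp only [LocalState.handled, List.length_tail] at h3 ⊢
  omega

theorem GoodRun.exists_leader_of_forall (h : GoodRun genesis order ρ X) {w : ℕ}
    (hw : ∀ i, Correct ρ i → ∃ t, ρ t = ⟨i, .chooseLeader w⟩) {i : Proc f} (hi : Correct ρ i) :
    ∃ t j, ρ t = ⟨i, .leader w j⟩ := by
  obtain ⟨S, hS⟩ := exists_finset_correct ρ
  have hT : ∀ j ∈ S, ∃ t, ρ t = ⟨j, .chooseLeader w⟩ := fun j hj => hw j ((hS j).1 hj)
  choose! T hT using hT
  obtain ⟨t, ht⟩ := hw i hi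
  obtain ⟨t', -, j, hj⟩ := h.coin_termination w ⟨S.sup T + 1, by
    have h1 := (h.toIsRun.card_correct hS).1
    have h2 : S.card ≤ (callers ρ w (S.sup T + 1)).ncard := by
      rw [← Set.ncard_coe_finset]
      exact Set.ncard_le_ncard
        (fun j hj => ⟨T j, Nat.lt_succ_iff.2 (Finset.le_sup hj), hT j hj⟩) (Set.toFinite _)
    omega⟩ i hi t ht
  exact ⟨t', j, hj⟩

/-- The induction treats all correct processes at once: an answer for wave `w` requires `f + 1`
callers, and these come from the other correct processes reaching that wave. -/
theorem GoodRun.exists_waiting (h : GoodRun genesis order ρ X) (w : ℕ) :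
    ∀ i, Correct ρ i → ∃ t, ¬ (stateAt genesis order ρ i t).calling ∧
      (stateAt genesis order ρ i t).handled = w := by
  induction w with
  | zero => exact fun i _ => ⟨0, id, by simp [stateAt, initialState, LocalState.handled]⟩
  | succ w ih =>
    intro i hi
    obtain ⟨t, j, ht⟩ := h.exists_leader_of_forall (w := w) (fun i hi => by
      obtain ⟨t, h1, h2⟩ := ih i hi
      exact h.exists_chooseLeader_of_waiting hi h1 h2) hi
    exact ⟨t + 1, h.handled_succ hi ht⟩

theorem GoodRun.exists_chooseLeader (h : GoodRun genesis order ρ X) (w : ℕ) {i : Proc f}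
    (hi : Correct ρ i) : ∃ t, ρ t = ⟨i, .chooseLeader w⟩ := by
  obtain ⟨t, h1, h2⟩ := h.exists_waiting w i hi
  exact h.exists_chooseLeader_of_waiting hi h1 h2

theorem GoodRun.exists_leader (h : GoodRun genesis order ρ X) (w : ℕ) {i : Proc f}
    (hi : Correct ρ i) : ∃ t j, ρ t = ⟨i, .leader w j⟩ :=
  h.exists_leader_of_forall (fun _ hj => h.exists_chooseLeader w hj) hi

end Waves

/-! ### The common core of a wave and its consequences for delivery -/

section Core

variable {f : ℕ} {Block : Type u} {genesis : Finset (Vertex f Block)}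
  {order : Finset (Vertex f Block) → List (Vertex f Block)} {ρ : ℕ → Event f Block}
  {X : ℕ → Proc f}

open Classical in
/-- `V` is a set of at least `2 f + 1` sources of strong edges of a vertex of the second round of
wave `w` to which `f + 1` vertices of the third round have strong edges. -/
def IsCore (D : Finset (Vertex f Block)) (w : ℕ) (V : Finset (Proc f)) : Prop :=
  2 * f + 1 ≤ V.card ∧ ∃ u ∈ D, u.round + 2 = 4 * w ∧
    (∀ p ∈ V, ∃ v ∈ u.strongEdges, v.source = p) ∧
    f + 1 ≤ (D.filter fun y => y.round + 1 = 4 * w ∧ u ∈ y.strongEdges).card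

/-- If each of `2 f + 1` elements is related to `2 f + 1` of at most `3 f + 1` elements, then some
of the latter is related to `f + 1` of the former. -/
theorem exists_popular {α β : Type*} {A : Finset α} {B : Finset β} (r : α → β → Prop)
    [∀ a b, Decidable (r a b)] (hA : 2 * f + 1 ≤ A.card) (hB : B.card ≤ 3 * f + 1)
    (h : ∀ a ∈ A, 2 * f + 1 ≤ (B.filter fun b => r a b).card) :
    ∃ b ∈ B, f + 1 ≤ (A.filter fun a => r a b).card := by
  by_contra hno
  push Not at hno
  -- Counting related pairs from both sides would give `(2f+1)² ≤ (3f+1) f`, which is false.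
  have h1 := Finset.sum_card_bipartiteAbove_eq_sum_card_bipartiteBelow (s := A) (t := B) r
  have h2 : A.card * (2 * f + 1) ≤ ∑ a ∈ A, (B.bipartiteAbove r a).card := by
    rw [← smul_eq_mul]
    exact Finset.card_nsmul_le_sum _ _ _ h
  have h3 : ∑ b ∈ B, (A.bipartiteBelow r b).card ≤ B.card * f := by
    rw [← smul_eq_mul]
    exact Finset.sum_le_card_nsmul _ _ _ fun b hb => Nat.lt_succ_iff.1 (hno b hb)
  have h4 := Nat.mul_le_mul_right (2 * f + 1) hA
  have h5 := Nat.mul_le_mul_right f hB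
  nlinarith

/-- This turns counts of vertices within one round into counts of processes, where quorums can be
intersected. -/
theorem GoodRun.injOn_source (h : GoodRun genesis order ρ X) {i : Proc f} (hi : Correct ρ i)
    {t r : ℕ} (hr : 1 ≤ r) {A : Finset (Vertex f Block)}
    (hA : ∀ v ∈ A, v ∈ (stateAt genesis order ρ i t).dag ∧ v.round = r) :
    Set.InjOn Vertex.source (A : Set (Vertex f Block)) := fun v hv v' hv' he =>
  h.vertex_unique hi hi (hA v hv).1 (hA v' hv').1 (by rw [(hA v hv).2]; exact hr)
    (by rw [(hA v hv).2, (hA v' hv').2]) he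

open Classical in
theorem GoodRun.strongEdges_mem (h : GoodRun genesis order ρ X) {i : Proc f} (hi : Correct ρ i)
    {t : ℕ} {v : Vertex f Block} (hv : v ∈ (stateAt genesis order ρ i t).dag) (hr : 1 ≤ v.round) :
    2 * f + 1 ≤ v.strongEdges.toFinset.card ∧ ∀ u ∈ v.strongEdges.toFinset,
      u ∈ (stateAt genesis order ρ i t).dag ∧ u.round = v.round - 1 := by
  have hval := (h.inv hi t).valid h.genesis_round hv hr
  refine ⟨hval.card_strongEdges, fun u hu => ?_⟩
  rw [List.mem_toFinset] at hu
  exact ⟨h.edgeClosed hi t v hv hr u (.inl hu), by have := hval.2.1 u hu; omega⟩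

theorem GoodRun.exists_isCore (h : GoodRun genesis order ρ X) {i : Proc f} (hi : Correct ρ i)
    {w t : ℕ} (hw : 1 ≤ w) (ht : ρ t = ⟨i, .chooseLeader w⟩) :
    ∃ V, IsCore (stateAt genesis order ρ i t).dag w V := by
  classical
  have hinv := h.inv hi t
  set D := (stateAt genesis order ρ i t).dag
  have hround := (hinv.head_waves.1 (h.toIsRun.enabled hi ht).2).2
  have hB : (layer D (4 * w - 2)).card ≤ 3 * f + 1 := by
    rw [← Finset.card_image_of_injOn (h.injOn_source hi (t := t) (r := 4 * w - 2) (by omega)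
      fun v hv => mem_layer.1 hv)]
    exact (Finset.card_le_univ _).trans_eq (Fintype.card_fin _)
  obtain ⟨u, hu, hA⟩ := exists_popular (f := f) (A := layer D (4 * w - 1))
    (fun a b => b ∈ a.strongEdges) (hinv.layers _ (by omega)) hB fun a ha => by
      rw [mem_layer] at ha
      obtain ⟨h1, h2⟩ := h.strongEdges_mem hi ha.1 (by omega)
      refine h1.trans (Finset.card_le_card fun x hx => ?_)
      refine Finset.mem_filter.2 ⟨mem_layer.2 ⟨(h2 x hx).1, ?_⟩, List.mem_toFinset.1 hx⟩
      rw [(h2 x hx).2]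
      omega
  rw [mem_layer] at hu
  obtain ⟨h1, h2⟩ := h.strongEdges_mem hi hu.1 (by omega)
  refine ⟨u.strongEdges.toFinset.image Vertex.source, ?_, u, hu.1, by omega, ?_, ?_⟩
  · rwa [Finset.card_image_of_injOn (h.injOn_source hi (r := u.round - 1) (by omega) h2)]
  · intro p hp
    obtain ⟨v, hv, hvp⟩ := Finset.mem_image.1 hp
    exact ⟨v, List.mem_toFinset.1 hv, hvp⟩
  · refine hA.trans (Finset.card_le_card fun y hy => ?_)
    simp only [Finset.mem_filter, mem_layer] at hy ⊢
    exact ⟨hy.1.1, by omega, hy.2⟩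

/-- If the leader of a wave belongs to a core, then every correct process that handles the wave
commits the leader vertex. -/
theorem GoodRun.commit (h : GoodRun genesis order ρ X) (horder : ∀ S, (order S).Perm S.toList)
    {p i : Proc f} (hp : Correct ρ p) (hi : Correct ρ i) {w t t' : ℕ} (hw : 1 ≤ w)
    {V : Finset (Proc f)} (hV : IsCore (stateAt genesis order ρ p t).dag w V) (hX : X w ∈ V)
    {j : Proc f} (ht' : ρ t' = ⟨i, .leader w j⟩) :
    ∃ v ∈ (stateAt genesis order ρ i t').dag, v.round + 3 = 4 * w ∧
      ∀ u ∈ (stateAt genesis order ρ i t').dag, 1 ≤ u.round →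
        Path (stateAt genesis order ρ i t').dag v u →
          (u.block, u.round, u.source) ∈ (stateAt genesis order ρ i (t' + 1)).output := by
  classical
  obtain ⟨-, u, hu, hur, hVu, hY⟩ := hV
  obtain ⟨v, hv, hvX⟩ := hVu _ hX
  have hinv := h.inv hi t'
  have hclosed := h.edgeClosed hi t'
  obtain ⟨hcall, hhead⟩ := h.toIsRun.enabled hi ht'
  have hlayer := hinv.layers (4 * w) (hinv.head_waves.1 hhead).2
  have hvr : v.round + 1 = u.round :=
    ((h.inv hp t).valid h.genesis_round hu (by omega)).2.1 v hv
  -- The `2f+1` sources below `z` and the `f+1` sources of vertices above `u` must meet among `3f+1`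
  -- processes. Equal round and source mean the same vertex, even in the DAGs of different
  -- processes, so `z` reaches `u` through it.
  have key : ∀ z ∈ layer (stateAt genesis order ρ i t').dag (4 * w),
      v ∈ (stateAt genesis order ρ i t').dag ∧
        StrongPath (stateAt genesis order ρ i t').dag z v := by
    intro z hz
    rw [mem_layer] at hz
    obtain ⟨h1, h2⟩ := h.strongEdges_mem hi hz.1 (by omega)
    rw [← Finset.card_image_of_injOn (h.injOn_source hi (r := z.round - 1) (by omega) h2)] at h1
    rw [← Finset.card_image_of_injOn (h.injOn_source hp (t := t) (r := 4 * w - 1) (by omega)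
      fun y hy => ⟨(Finset.mem_filter.1 hy).1, by
        have := (Finset.mem_filter.1 hy).2.1
        omega⟩)] at hY
    obtain ⟨q, hq⟩ : (z.strongEdges.toFinset.image Vertex.source ∩
        ((stateAt genesis order ρ p t).dag.filter fun y =>
          y.round + 1 = 4 * w ∧ u ∈ y.strongEdges).image Vertex.source).Nonempty := by
      rw [← Finset.card_pos]
      have h3 := Finset.card_union_add_card_inter (z.strongEdges.toFinset.image Vertex.source)
        (((stateAt genesis order ρ p t).dag.filter fun y =>
          y.round + 1 = 4 * w ∧ u ∈ y.strongEdges).image Vertex.source)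
      have h4 := (Finset.card_le_univ (z.strongEdges.toFinset.image Vertex.source ∪
        ((stateAt genesis order ρ p t).dag.filter fun y =>
          y.round + 1 = 4 * w ∧ u ∈ y.strongEdges).image Vertex.source)).trans_eq
            (Fintype.card_fin _)
      omega
    rw [Finset.mem_inter, Finset.mem_image, Finset.mem_image] at hq
    obtain ⟨⟨x, hx, hxq⟩, y, hy, hyq⟩ := hq
    rw [Finset.mem_filter] at hy
    obtain ⟨hxD, hxr⟩ := h2 x hx
    have hxy : x = y := h.vertex_unique hi hp hxD hy.1 (by omega) (by omega) (hxq.trans hyq.symm)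
    subst hxy
    have huD := hclosed x hxD (by omega) u (.inl hy.2.2)
    have hvD := hclosed u huD (by omega) v (.inl hv)
    refine ⟨hvD, ?_⟩
    exact ((Relation.ReflTransGen.single ⟨hxD, by omega, List.mem_toFinset.1 hx⟩).tail
      ⟨huD, by omega, hy.2.2⟩).tail ⟨hvD, by omega, hv⟩
  obtain ⟨z₀, hz₀⟩ := Finset.card_pos.1 (lt_of_lt_of_le (Nat.succ_pos _) hlayer)
  have hvD := (key z₀ hz₀).1
  refine ⟨v, hvD, by omega, fun x hx hxr hpath => ?_⟩
  rw [stateAt_succ ht']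
  have hjX := h.coin_agreement i w j hi ⟨t', ht'⟩
  have hleader : waveLeader { stateAt genesis order ρ i t' with
      waves := (stateAt genesis order ρ i t').waves.tail
      calling := False
      coin := Function.update (stateAt genesis order ρ i t').coin w (some j) } w = some v := by
    have hex : ∃ v ∈ (stateAt genesis order ρ i t').dag, (v.round : ℤ) = waveRound w 1 ∧
        Function.update (stateAt genesis order ρ i t').coin w (some j) w = some v.source :=
      ⟨v, hvD, by simp only [waveRound]; omega, by simp [hjX, hvX]⟩
    -- The choice in `waveLeader` is harmless: the round and the source determine the vertex.
    rw [waveLeader, dif_pos hex]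
    have hs := hex.choose_spec
    generalize hex.choose = v' at hs ⊢
    have h1 := hs.2.1
    have h2 := hs.2.2
    simp only [waveRound] at h1
    rw [Function.update_self, Option.some_inj] at h2
    rw [h.vertex_unique hi hi hs.1 hvD (by omega) (by omega) (by rw [← h2, hjX, hvX])]
  exact waveReady_output horder
    (s := { stateAt genesis order ρ i t' with
      waves := (stateAt genesis order ρ i t').waves.tail
      calling := False
      coin := Function.update (stateAt genesis order ρ i t').coin w (some j) })
    (stateAt_deliveredOutput horder i t') hleader hlayer
    (fun y hy => ⟨(mem_layer.1 hy).1, by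
      have := (mem_layer.1 hy).2
      simp only [waveRound]
      omega, (key y hy).2⟩) hx hxr hpath

/-- If a block of a correct process is never delivered, then from some wave on no leader belongs to
a core. -/
theorem GoodRun.eventually_notMem_core (h : GoodRun genesis order ρ X)
    (horder : ∀ S, (order S).Perm S.toList) {k i : Proc f} (hk : Correct ρ k) (hi : Correct ρ i)
    {t₀ : ℕ} {b : Block} {r : ℕ} (ht₀ : ρ t₀ = ⟨k, .aBcast b r⟩)
    (hout : ∀ t, (b, r, k) ∉ (stateAt genesis order ρ i t).output) :
    ∃ W, ∀ w ≥ W, ∀ p t V, Correct ρ p → IsCore (stateAt genesis order ρ p t).dag w V →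
      X w ∉ V := by
  classical
  obtain ⟨x, rfl, rfl, rfl, hx1, tx, hx⟩ := h.exists_vertex_of_aBcast hk ht₀
  obtain ⟨S, hS⟩ := exists_finset_correct ρ
  have hT : ∀ j ∈ S, ∃ t, x ∈ (stateAt genesis order ρ j t).dag := fun j hj =>
    h.exists_mem_dag_of_mem hk ((hS j).1 hj) hx
  choose! T hT using hT
  -- The leader vertex has round `4w-3` and its strong edges lead to round `4w-4`. This `W` puts
  -- that round above every round in which the correct processes were when `x` had entered their
  -- DAGs.
  refine ⟨S.sup (fun j => (stateAt genesis order ρ j (T j)).round) + 3,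
    fun w hw p t V hp hV hX => ?_⟩
  obtain ⟨t', j, ht'⟩ := h.exists_leader w hi
  obtain ⟨v, hv, hvr, hdel⟩ := h.commit horder hp hi (by omega) hV hX ht'
  obtain ⟨h1, h2⟩ := h.strongEdges_mem hi hv (by omega)
  rw [← Finset.card_image_of_injOn (h.injOn_source hi (r := v.round - 1) (by omega) h2)] at h1
  -- Among `2f+1` sources, at most `f` are corrupted.
  obtain ⟨q, hq, hqS⟩ : ∃ q ∈ v.strongEdges.toFinset.image Vertex.source, q ∉ Sᶜ := by
    by_contra hno
    push Not at hno
    have h3 := Finset.card_le_card (show v.strongEdges.toFinset.image Vertex.source ⊆ Sᶜ from hno)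
    have h4 := (h.toIsRun.card_correct hS).2
    omega
  rw [Finset.mem_compl, not_not] at hqS
  obtain ⟨e, he, heq⟩ := Finset.mem_image.1 hq
  obtain ⟨heD, her⟩ := h2 e he
  have hqc := (hS q).1 hqS
  have hsup : (stateAt genesis order ρ q (T q)).round ≤
      S.sup (fun j => (stateAt genesis order ρ j (T j)).round) :=
    Finset.le_sup (f := fun j => (stateAt genesis order ρ j (T j)).round) hqS
  obtain ⟨t₁, b, h5, h6⟩ := h.eq_newVertex hi hqc heD (by omega) heq
  -- Process `q` created `e` in a round later than its round at time `T q`, so `x` was already in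
  -- its DAG.
  have hle : T q ≤ t₁ := by
    by_contra hlt
    have := (stateAt_le (genesis := genesis) (order := order) (ρ := ρ) (i := q)
      (by omega : t₁ ≤ T q)).round
    omega
  have hxr := (h.inv hqc (T q)).dag_round x (hT q hqS)
  have hpath := path_newVertex q b ((stateAt_le hle).dag (hT q hqS)) hx1
    (show x.round < e.round by omega)
  rw [← h6] at hpath
  obtain ⟨h7, h8, -⟩ := (h.edgeClosed hi t').path heD (by omega) hpath
  exact hout (t' + 1) (hdel x h8 hx1
    (h7.head ⟨heD, by omega, .inl (List.mem_toFinset.1 he)⟩))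

end Core

/-! ### The coin against the core, and the limit argument -/

section Probability

variable {f : ℕ} {Block : Type u} {genesis : Finset (Vertex f Block)}
  {order : Finset (Vertex f Block) → List (Vertex f Block)}
  {Ω : Type v} [MeasurableSpace Ω] {P : Measure Ω} {ℱ : Filtration ℕ ‹MeasurableSpace Ω›}
  {run : Ω → ℕ → Event f Block}

/-- A decreasing sequence of events has a null intersection if almost every point of it lies in
almost all events of a sequence that have conditional probability at most `q < 1`. -/
theorem measure_iInter_eq_zero_of_conditional [IsProbabilityMeasure P] {C B : ℕ → Set Ω}
    (hC : Antitone C) (hCm : ∀ T, MeasurableSet (C T)) {q : ENNReal} (hq : q < 1)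
    (hB : ∀ T w, T ≤ w → P (C T ∩ B w) ≤ q * P (C T))
    (hev : ∀ᵐ ω ∂P, ω ∈ ⋂ T, C T → ∃ W, ∀ w ≥ W, ω ∈ B w) : P (⋂ T, C T) = 0 := by
  have hlimC : Filter.Tendsto (fun T => P (C T)) Filter.atTop (nhds (P (⋂ T, C T))) :=
    tendsto_measure_iInter_atTop (fun T => (hCm T).nullMeasurableSet) hC ⟨0, measure_ne_top _ _⟩
  have hlim : Filter.Tendsto (fun T => q * P (C T)) Filter.atTop (nhds (q * P (⋂ T, C T))) :=
    ENNReal.Tendsto.const_mul hlimC (.inr (hq.trans_le le_top).ne)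
  -- For fixed `W`, the single wave `max W T` already gives the bound `q * P (C T)`; then `T` tends
  -- to infinity.
  have hW : ∀ W, P ((⋂ T, C T) ∩ {ω | ∀ w ≥ W, ω ∈ B w}) ≤ q * P (⋂ T, C T) := by
    refine fun W => ge_of_tendsto' hlim fun T => le_trans ?_ (hB T _ (le_max_right W T))
    exact measure_mono fun ω hω => ⟨Set.mem_iInter.1 hω.1 T, hω.2 _ (le_max_left W T)⟩
  have hle : P (⋂ T, C T) ≤ q * P (⋂ T, C T) := by
    calc P (⋂ T, C T) ≤ P (⋃ W, (⋂ T, C T) ∩ {ω | ∀ w ≥ W, ω ∈ B w}) := by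
          refine measure_mono_ae ?_
          filter_upwards [hev] with ω hω hN
          obtain ⟨W, hW⟩ := hω hN
          exact Set.mem_iUnion.2 ⟨W, hN, hW⟩
      _ = ⨆ W, P ((⋂ T, C T) ∩ {ω | ∀ w ≥ W, ω ∈ B w}) :=
          Monotone.measure_iUnion fun W W' h ω hω => ⟨hω.1, fun w hw => hω.2 w (h.trans hw)⟩
      _ ≤ _ := iSup_le hW
  by_contra hne
  have : q * P (⋂ T, C T) < 1 * P (⋂ T, C T) :=
    ENNReal.mul_lt_mul_left hne (measure_ne_top _ _) hq
  rw [one_mul] at this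
  exact absurd hle (not_le.2 this)

/-- An event that is determined by the first `t + 1` events of the run is known at time `t`. -/
theorem measurableSet_of_prefix
    (hadapted : ∀ t, @Measurable Ω (List (Event f Block)) (ℱ t) ⊤
      (fun ω => (List.range (t + 1)).map (run ω))) {t : ℕ} {U : Set Ω}
    (hU : ∀ ω ω', (∀ s ≤ t, run ω s = run ω' s) → ω ∈ U → ω' ∈ U) : MeasurableSet[ℱ t] U := by
  -- All sets of lists are measurable here, so `U`, a union of fibres of the prefix map, is the
  -- preimage of its own image.
  have h := hadapted t
    (show MeasurableSet[⊤] ((fun ω => (List.range (t + 1)).map (run ω)) '' U) from trivial)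
  convert h using 1
  refine Set.Subset.antisymm (Set.subset_preimage_image _ _) ?_
  rintro ω ⟨ω', hω', he⟩
  refine hU ω' ω (fun s hs => ?_) hω'
  exact List.map_inj_left.1 he s (List.mem_range.2 (Nat.lt_succ_iff.2 hs))

open Classical in
/-- A core of a local DAG, if there is one. -/
noncomputable def core (D : Finset (Vertex f Block)) (w : ℕ) : Finset (Proc f) :=
  if h : ∃ V, IsCore D w V then h.choose else ∅

theorem isCore_core {D : Finset (Vertex f Block)} {w : ℕ} (h : ∃ V, IsCore D w V) :
    IsCore D w (core D w) := by
  rw [core, dif_pos h]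
  exact h.choose_spec

/-- At time `t`, for the first time a process in `S` calls the coin for wave `w`, and `V` is the
core of its DAG. -/
def FirstCall (genesis : Finset (Vertex f Block))
    (order : Finset (Vertex f Block) → List (Vertex f Block)) (S : Finset (Proc f))
    (ρ : ℕ → Event f Block) (w t : ℕ) (V : Finset (Proc f)) : Prop :=
  (∃ p ∈ S, ρ t = ⟨p, .chooseLeader w⟩ ∧ core (stateAt genesis order ρ p t).dag w = V) ∧
    ∀ t' < t, ∀ p ∈ S, ρ t' ≠ ⟨p, .chooseLeader w⟩

theorem FirstCall.congr {S : Finset (Proc f)} {ρ ρ' : ℕ → Event f Block} {w t : ℕ}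
    {V : Finset (Proc f)} (hρ : ∀ s ≤ t, ρ s = ρ' s) (h : FirstCall genesis order S ρ w t V) :
    FirstCall genesis order S ρ' w t V := by
  obtain ⟨⟨p, hp, h1, h2⟩, h3⟩ := h
  refine ⟨⟨p, hp, hρ t le_rfl ▸ h1, ?_⟩, fun t' ht' => hρ t' ht'.le ▸ h3 t' ht'⟩
  rw [← h2, stateAt_congr p fun s hs => hρ s hs.le]

/-- A run has one event per time, so the first call fixes the caller and its core. This makes the
events in the later sum disjoint. -/
theorem FirstCall.unique {S : Finset (Proc f)} {ρ : ℕ → Event f Block} {w t t' : ℕ}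
    {V V' : Finset (Proc f)} (h : FirstCall genesis order S ρ w t V)
    (h' : FirstCall genesis order S ρ w t' V') : t = t' ∧ V = V' := by
  obtain ⟨⟨p, hp, h1, h2⟩, h3⟩ := h
  obtain ⟨⟨p', hp', h1', h2'⟩, h3'⟩ := h'
  have ht : t = t' := by
    rcases lt_trichotomy t t' with h | h | h
    · exact absurd h1 (h3' t h p hp)
    · exact h
    · exact absurd h1' (h3 t' h p' hp')
  subst ht
  rw [h1] at h1'
  have hpp : p = p' := by simpa using h1'
  subst hpp
  exact ⟨rfl, h2.symm.trans h2'⟩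

/-- Earlier callers lie outside `S`. The first call itself, at time `t`, does not count in `callers
ρ w t`, so unpredictability still applies when the core is already known. -/
theorem FirstCall.callers_lt {S : Finset (Proc f)} (hS : Sᶜ.card ≤ f) {ρ : ℕ → Event f Block}
    {w t : ℕ} {V : Finset (Proc f)} (h : FirstCall genesis order S ρ w t V) :
    (callers ρ w t).ncard < f + 1 := by
  rw [Nat.lt_succ_iff]
  refine le_trans ?_ hS
  rw [← Set.ncard_coe_finset]
  refine Set.ncard_le_ncard ?_ (Set.toFinite _)
  rintro p ⟨t', ht', hp⟩
  simp only [Finset.coe_compl, Set.mem_compl_iff, Finset.mem_coe]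
  exact fun hpS => h.2 t' ht' p hpS hp

variable {X : ℕ → Ω → Proc f} {ε : ℝ}

/-- As long as few processes have called the coin, it misses a set of `2 f + 1` processes with
probability at most `f (1/n + ε)`. -/
theorem GlobalPerfectCoin.measure_notMem_le [IsProbabilityMeasure P]
    (hcoin : GlobalPerfectCoin P ℱ run X ε) {w t : ℕ} {A : Set Ω} (hA : MeasurableSet[ℱ t] A)
    (hcall : ∀ ω ∈ A, (callers (run ω) w t).ncard < f + 1) {V : Finset (Proc f)}
    (hV : 2 * f + 1 ≤ V.card) :
    P (A ∩ {ω | X w ω ∉ V}) ≤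
      ENNReal.ofReal (f * max (1 / (3 * f + 1 : ℕ) + ε) 0) * P A := by
  classical
  have hcard : Vᶜ.card ≤ f := by
    have := Finset.card_add_card_compl V
    rw [Fintype.card_fin] at this
    omega
  set c : ℝ := 1 / (3 * f + 1 : ℕ) + ε
  have hsub : A ∩ {ω | X w ω ∉ V} ⊆ ⋃ j ∈ Vᶜ, A ∩ {ω | X w ω = j} := by
    rintro ω ⟨h1, h2⟩
    simp only [Set.mem_iUnion]
    exact ⟨X w ω, Finset.mem_compl.2 h2, h1, rfl⟩
  -- Each of the at most `f` processes outside `V` contributes one guess. The maximum with `0`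
  -- covers a negative `c`, where replacing the number of guesses by `f` could fail.
  have hreal : P.real (A ∩ {ω | X w ω ∉ V}) ≤ f * max c 0 * P.real A := by
    calc P.real (A ∩ {ω | X w ω ∉ V}) ≤ P.real (⋃ j ∈ Vᶜ, A ∩ {ω | X w ω = j}) :=
          measureReal_mono hsub (measure_ne_top _ _)
      _ ≤ ∑ j ∈ Vᶜ, P.real (A ∩ {ω | X w ω = j}) := measureReal_biUnion_finset_le _ _
      _ ≤ ∑ j ∈ Vᶜ, max c 0 * P.real A := Finset.sum_le_sum fun j _ =>
          (hcoin.unpredictability w t j A hA hcall).trans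
            (mul_le_mul_of_nonneg_right (le_max_left _ _) measureReal_nonneg)
      _ = Vᶜ.card * (max c 0 * P.real A) := by rw [Finset.sum_const, nsmul_eq_mul]
      _ ≤ f * (max c 0 * P.real A) := mul_le_mul_of_nonneg_right (by exact_mod_cast hcard)
          (mul_nonneg (le_max_right _ _) measureReal_nonneg)
      _ = _ := by ring
  rw [← ofReal_measureReal (μ := P) (s := A), ← ENNReal.ofReal_mul (by positivity),
    ← ofReal_measureReal (μ := P)]
  exact ENNReal.ofReal_le_ofReal hreal

/-- The coin of wave `w` misses the core of the first caller in `S`. -/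
def MissesCore (genesis : Finset (Vertex f Block))
    (order : Finset (Vertex f Block) → List (Vertex f Block)) (S : Finset (Proc f))
    (run : Ω → ℕ → Event f Block) (X : ℕ → Ω → Proc f) (w : ℕ) : Set Ω :=
  {ω | ∃ t V, w ≤ t ∧ 2 * f + 1 ≤ V.card ∧ FirstCall genesis order S (run ω) w t V ∧ X w ω ∉ V}

/-- Split according to the time `t` and the core `V` of the first call. As `T ≤ w ≤ t`, each piece
of `C` is known at time `t`, so the coin bound applies to it; the disjoint pieces then add up to at
most `C`. -/
theorem GlobalPerfectCoin.measure_inter_missesCore_le [IsProbabilityMeasure P]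
    (hcoin : GlobalPerfectCoin P ℱ run X ε)
    (hadapted : ∀ t, @Measurable Ω (List (Event f Block)) (ℱ t) ⊤
      (fun ω => (List.range (t + 1)).map (run ω)))
    {S : Finset (Proc f)} (hS : Sᶜ.card ≤ f) {T w : ℕ} (hTw : T ≤ w) {C : Set Ω}
    (hC : MeasurableSet[ℱ T] C) :
    P (C ∩ MissesCore genesis order S run X w) ≤
      ENNReal.ofReal (f * max (1 / (3 * f + 1 : ℕ) + ε) 0) * P C := by
  classical
  set q := ENNReal.ofReal (f * max (1 / (3 * f + 1 : ℕ) + ε) 0)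
  let G : ℕ × Finset (Proc f) → Set Ω := fun x =>
    C ∩ {ω | w ≤ x.1 ∧ 2 * f + 1 ≤ x.2.card ∧ FirstCall genesis order S (run ω) w x.1 x.2}
  have hG : ∀ x, w ≤ x.1 → MeasurableSet[ℱ x.1] (G x) := fun x hx =>
    (ℱ.mono (hTw.trans hx) _ hC).inter (measurableSet_of_prefix hadapted
      fun ω ω' hω h => ⟨h.1, h.2.1, h.2.2.congr hω⟩)
  have hG_empty : ∀ x, ¬ (w ≤ x.1 ∧ 2 * f + 1 ≤ x.2.card) → G x = ∅ := fun x hx =>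
    Set.eq_empty_of_forall_notMem fun ω hω => hx ⟨hω.2.1, hω.2.2.1⟩
  have hGm : ∀ x, MeasurableSet (G x) := fun x => by
    by_cases hx : w ≤ x.1 ∧ 2 * f + 1 ≤ x.2.card
    · exact ℱ.le _ _ (hG x hx.1)
    · rw [hG_empty x hx]
      exact MeasurableSet.empty
  have hdisj : Pairwise (Function.onFun Disjoint G) := fun x y hxy =>
    Set.disjoint_left.2 fun ω hx hy => hxy (by
      obtain ⟨h1, h2⟩ := hx.2.2.2.unique hy.2.2.2
      exact Prod.ext h1 h2)
  calc P (C ∩ MissesCore genesis order S run X w)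
      ≤ P (⋃ x, G x ∩ {ω | X w ω ∉ x.2}) := by
        refine measure_mono ?_
        rintro ω ⟨hω, t, V, h1, h2, h3, h4⟩
        exact Set.mem_iUnion.2 ⟨(t, V), ⟨hω, h1, h2, h3⟩, h4⟩
    _ ≤ ∑' x, P (G x ∩ {ω | X w ω ∉ x.2}) := measure_iUnion_le _
    _ ≤ ∑' x, q * P (G x) := ENNReal.tsum_le_tsum fun x => by
        by_cases hx : w ≤ x.1 ∧ 2 * f + 1 ≤ x.2.card
        · exact hcoin.measure_notMem_le (hG x hx.1)
            (fun ω hω => hω.2.2.2.callers_lt hS) hx.2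
        · rw [hG_empty x hx]
          simp
    _ = q * P (⋃ x, G x) := by rw [ENNReal.tsum_mul_left, measure_iUnion hdisj hGm]
    _ ≤ q * P C := by
        gcongr
        exact Set.iUnion_subset fun x => Set.inter_subset_left

/-- Up to time `T`, the processes in `S` are not corrupted and `i` has not output what `k`
atomically broadcasts at time `t₀`. -/
def Undelivered (genesis : Finset (Vertex f Block))
    (order : Finset (Vertex f Block) → List (Vertex f Block)) (S : Finset (Proc f)) (k i : Proc f)
    (t₀ T : ℕ) (ρ : ℕ → Event f Block) : Prop :=
  (∀ p ∈ S, ∀ t ≤ T, ρ t ≠ ⟨p, .corrupt⟩) ∧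
    (t₀ ≤ T → ∃ b r, ρ t₀ = ⟨k, .aBcast b r⟩ ∧
      ∀ t ≤ T, (b, r, k) ∉ (stateAt genesis order ρ i t).output)

theorem GoodRun.eventually_missesCore {Ω : Type v} {run : Ω → ℕ → Event f Block}
    {X : ℕ → Ω → Proc f} {ω : Ω}
    (h : GoodRun genesis order (run ω) fun w => X w ω)
    (horder : ∀ S, (order S).Perm S.toList) {S : Finset (Proc f)} {k i : Proc f} (hk : k ∈ S)
    (hi : i ∈ S) {t₀ : ℕ} (hω : ∀ T, Undelivered genesis order S k i t₀ T (run ω)) :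
    ∃ W, ∀ w ≥ W, ω ∈ MissesCore genesis order S run X w := by
  classical
  have hS : ∀ p ∈ S, Correct (run ω) p := fun p hp t => (hω t).1 p hp t le_rfl
  obtain ⟨b, r, hb, -⟩ := (hω t₀).2 le_rfl
  have hout : ∀ t, (b, r, k) ∉ (stateAt genesis order (run ω) i t).output := by
    intro t
    obtain ⟨b', r', hb', h'⟩ := (hω (max t t₀)).2 (le_max_right _ _)
    rw [hb] at hb'
    obtain ⟨rfl, rfl⟩ : b = b' ∧ r = r' := by simpa using hb'
    exact h' t (le_max_left _ _)
  obtain ⟨W, hW⟩ := h.eventually_notMem_core horder (hS k hk) (hS i hi) hb hout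
  -- Wave `0` has no core, hence the bound `1`.
  refine ⟨max W 1, fun w hw => ?_⟩
  have hex : ∃ t, ∃ p ∈ S, run ω t = ⟨p, .chooseLeader w⟩ := by
    obtain ⟨t, ht⟩ := h.exists_chooseLeader w (hS i hi)
    exact ⟨t, i, hi, ht⟩
  obtain ⟨p, hp, hcall⟩ := Nat.find_spec hex
  have hc := isCore_core
    (h.exists_isCore (hS p hp) (le_trans (le_max_right W 1) hw) hcall)
  refine ⟨Nat.find hex, _, ?_, hc.1, ⟨⟨p, hp, hcall, rfl⟩, fun t' ht' p' hp' he =>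
    Nat.find_min hex ht' ⟨p', hp', he⟩⟩, hW w (le_trans (le_max_left W 1) hw) p _ _ (hS p hp) hc⟩
  -- A caller of wave `w` is past round `4w`, and at most one round is entered per event; hence the
  -- call comes at time `w` or later.
  have h1 := ((h.inv (hS p hp) _).head_waves.1 (h.toIsRun.enabled (hS p hp) hcall).2).2
  have h2 := stateAt_round_le (genesis := genesis) (order := order) (ρ := run ω) p (Nat.find hex)
  omega

theorem ae_not_undelivered [IsProbabilityMeasure P]
    (hadapted : ∀ t, @Measurable Ω (List (Event f Block)) (ℱ t) ⊤
      (fun ω => (List.range (t + 1)).map (run ω)))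
    (hgood : ∀ᵐ ω ∂P, GoodRun genesis order (run ω) fun w => X w ω)
    (horder : ∀ S, (order S).Perm S.toList)
    (hε : (f : ℝ) * (1 / (3 * f + 1 : ℕ) + ε) < 1) (hcoin : GlobalPerfectCoin P ℱ run X ε)
    {S : Finset (Proc f)} (hS : Sᶜ.card ≤ f) {k i : Proc f} (hk : k ∈ S) (hi : i ∈ S) (t₀ : ℕ) :
    ∀ᵐ ω ∂P, ¬ ∀ T, Undelivered genesis order S k i t₀ T (run ω) := by
  have hC : ∀ T, MeasurableSet[ℱ T] {ω | Undelivered genesis order S k i t₀ T (run ω)} := by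
    refine fun T => measurableSet_of_prefix hadapted ?_
    rintro ω ω' hω ⟨h1, h2⟩
    refine ⟨fun p hp t ht => hω t ht ▸ h1 p hp t ht, fun ht₀ => ?_⟩
    obtain ⟨b, r, hb, h3⟩ := h2 ht₀
    refine ⟨b, r, hω t₀ ht₀ ▸ hb, fun t ht => ?_⟩
    rw [← stateAt_congr i fun s hs => hω s (hs.le.trans ht)]
    exact h3 t ht
  have hq : ENNReal.ofReal (f * max (1 / (3 * f + 1 : ℕ) + ε) 0) < 1 := by
    rw [ENNReal.ofReal_lt_one, mul_max_of_nonneg _ _ (Nat.cast_nonneg f), mul_zero]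
    exact max_lt hε one_pos
  have := measure_iInter_eq_zero_of_conditional (P := P)
    (C := fun T => {ω | Undelivered genesis order S k i t₀ T (run ω)})
    (B := MissesCore genesis order S run X)
    (fun T T' hT ω hω => ⟨fun p hp t ht => hω.1 p hp t (ht.trans hT), fun ht₀ => by
      obtain ⟨b, r, hb, h⟩ := hω.2 (ht₀.trans hT)
      exact ⟨b, r, hb, fun t ht => h t (ht.trans hT)⟩⟩)
    (fun T => ℱ.le T _ (hC T)) hq
    (fun T w hTw => hcoin.measure_inter_missesCore_le hadapted hS hTw (hC T))
    (by
      filter_upwards [hgood] with ω hω hN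
      exact hω.eventually_missesCore horder hk hi (Set.mem_iInter.1 hN))
  rw [measure_eq_zero_iff_ae_notMem] at this
  filter_upwards [this] with ω hω hN
  exact hω (Set.mem_iInter.2 hN)

end Probability

end DagRider

/-! ### Conclusion by a countable union -/

theorem mainTheorem3 {Block : Type*} (f : ℕ)
    -- the hardcoded round `0` of the DAG
    (genesis : Finset (DagRider.Vertex f Block))
    (hgenesis_card : genesis.card = 2 * f + 1)
    (hgenesis_round : ∀ v ∈ genesis, v.round = 0)
    -- the deterministic order in which sets of vertices are delivered
    (order : Finset (DagRider.Vertex f Block) → List (DagRider.Vertex f Block))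
    (horder : ∀ S, (order S).Perm S.toList)
    -- a random run of the protocol, chosen by the adversary on the basis of what it knows
    {Ω : Type*} [MeasurableSpace Ω] (P : Measure Ω) [IsProbabilityMeasure P]
    (ℱ : Filtration ℕ ‹MeasurableSpace Ω›)
    (run : Ω → ℕ → DagRider.Event f Block)
    (hadapted : ∀ t, @Measurable Ω (List (DagRider.Event f Block)) (ℱ t) ⊤
      (fun ω => (List.range (t + 1)).map (run ω)))
    (hrun : ∀ ω, DagRider.IsRun genesis order (run ω))
    -- the two building blocks
    (hrb : DagRider.ReliableBroadcast P run)
    (X : ℕ → Ω → DagRider.Proc f) (ε : ℝ)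
    (hε : (f : ℝ) * (1 / (3 * f + 1 : ℕ) + ε) < 1)
    (hcoin : DagRider.GlobalPerfectCoin P ℱ run X ε) :
    ∀ᵐ ω ∂P, DagRider.BABValidity genesis order (run ω) := by
  have hgood : ∀ᵐ ω ∂P, DagRider.GoodRun genesis order (run ω) fun w => X w ω := by
    filter_upwards [hrb.agreement, hrb.validity] with ω h1 h2
    exact { hrun ω with
      genesis_card := hgenesis_card.ge
      genesis_round := hgenesis_round
      rb_agreement := h1
      rb_integrity := hrb.integrity ω
      rb_validity := h2
      coin_agreement := hcoin.agreement ω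
      coin_termination := hcoin.termination ω }
  -- The correct set, the two processes and the time of the call depend on the run, but they range
  -- over countably many values. The block and its number are read off from the event at time `t₀`,
  -- so `Block` may be uncountable.
  have hall : ∀ᵐ ω ∂P, ∀ (S : Finset (DagRider.Proc f)) (k i : DagRider.Proc f) (t₀ : ℕ),
      Sᶜ.card ≤ f ∧ k ∈ S ∧ i ∈ S →
        ¬ ∀ T, DagRider.Undelivered genesis order S k i t₀ T (run ω) := by
    simp only [ae_all_iff]
    rintro S k i t₀ ⟨hS, hk, hi⟩
    exact DagRider.ae_not_undelivered hadapted hgood horder hε hcoin hS hk hi t₀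
  filter_upwards [hall] with ω hω k b r hk ⟨t₀, ht₀⟩ i hi
  by_contra hno
  push Not at hno
  obtain ⟨S, hS⟩ := DagRider.exists_finset_correct (run ω)
  exact hω S k i t₀ ⟨((hrun ω).card_correct hS).2, (hS k).2 hk, (hS i).2 hi⟩ fun T =>
    ⟨fun p hp t _ => (hS p).1 hp t, fun _ => ⟨b, r, ht₀, fun t _ => hno t⟩⟩
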